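/- Let $d\ge 3$, let $T_d$ be the infinite $d$-regular tree and let $S$ be a finite set. For a probability measure $\mu$ on $S^{V(T_d)}$ that is invariant under $\mathrm{Aut}(T_d)$ and a finite set $F\subset V(T_d)$, let $\mu_F$ denote the marginal of $\mu$ on $S^F$, let $\nu_F$ denote the product measure of the one-vertex marginals of $\mu_F$, let $h(F)=h(\mu_F)=-\sum_{x\in S^F}\mu_F(x)\ln\mu_F(x)$, and let $t(F)=h(\nu_F)-h(F)$ be the total correlation. A sequence of finite graphs $G_i$ is a large girth sequence if for every $\varepsilon>0$ and all sufficiently large $i$ the probability that a uniformly random vertex of $G_i$ lies on a cycle of length at most $\lceil 1/\varepsilon\rceil$ is at most $\varepsilon$. An invariant process $\mu$ with values in $S$ is called typical if there is a fixed sequence $n_1,n_2,\dots$ of positive integers such that, for independent uniformly random (simple, labeled) $d$-regular graphs $\mathbb G_{n_i}$ on $n_i$ vertices, the following holds with probability $1$: $(\mathbb G_{n_i})_i$ is a large girth sequence and there are colorings $f_i:V(\mathbb G_{n_i})\to S$ such that $(\mathbb G_{n_i},f_i)$ converges to $\mu$ in the Benjamini--Schramm sense, i.e. for every $r$ the law of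 the isomorphism class of the rooted colored $r$-neighborhood of a uniformly random vertex of $\mathbb G_{n_i}$ converges to the law of the isomorphism class of the $\mu$-random colored $r$-neighborhood of the root of $T_d$. **Proposition 4.5.** Let $C$ be the degree-$d$ star in $T_d$ with center $o$ and leaves $w_1,\dots,w_d$. Let $\mu$ be a typical process with values in $S$ and suppose that $h(C)-h(C\setminus\{w_1\})\le b$ for some $b\ge 0$. Then $$t(C\setminus\{w_1\})\le b\,\frac{2d-2}{d-2}$$ and $$d_{TV}\bigl(\mu_{C\setminus\{w_1\}},\nu_{C\setminus\{w_1\}}\bigr)\le\sqrt{b\,\frac{d-1}{d-2}},$$ where $d_{TV}(P,Q)=\sup_A|P(A)-Q(A)|$. -/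

import Mathlib

open MeasureTheory Filter Topology

noncomputable section

/-! ### The `d`-regular tree -/

/-- Vertices of the `d`-regular tree `T_d`: the reduced words in the free product of `d` copies of
the group with two elements, that is, the words in `d` letters without equal consecutive letters. -/
abbrev TreeVertex (d : ℕ) : Type :=
  {l : List (Fin d) // l.IsChain (· ≠ ·)}

/-- The `d`-regular tree `T_d`: two reduced words are adjacent if one of them arises from the other
by putting one more letter in front. -/
def regularTree (d : ℕ) : SimpleGraph (TreeVertex d) where
  Adj u v := ∃ a : Fin d, v.1 = a :: u.1 ∨ u.1 = a :: v.1
  symm := ⟨fun _ _ ⟨a, h⟩ => ⟨a, h.symm⟩⟩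
  loopless := ⟨fun u ⟨a, h⟩ => by rcases h with h | h <;> simpa using congrArg List.length h⟩

/-- The distinguished vertex of the rooted tree `T_d^*`. -/
def treeRoot (d : ℕ) : TreeVertex d := ⟨[], List.isChain_nil⟩

/-- The neighbors of `u` correspond to the `d` letters: a letter is removed from the front of `u`
if it stands there, and is put in front of `u` otherwise. -/
theorem regularTree_neighborSet (d : ℕ) (u : TreeVertex d) :
    Subtype.val '' (regularTree d).neighborSet u =
      Set.range fun a : Fin d => if u.1.head? = some a then u.1.tail else a :: u.1 := by
  obtain ⟨l, hl⟩ := u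
  ext m
  simp only [Set.mem_image, SimpleGraph.mem_neighborSet, regularTree, Set.mem_range]
  constructor
  · rintro ⟨⟨m, hm⟩, ⟨a, h | h⟩, rfl⟩
    · refine ⟨a, ?_⟩
      simp only at h
      subst h
      rw [if_neg]
      intro h
      exact (List.isChain_cons.1 hm).1 a h rfl
    · refine ⟨a, ?_⟩
      simp only at h
      subst h
      simp
  · rintro ⟨a, rfl⟩
    split_ifs with h
    · obtain ⟨t, rfl⟩ := List.head?_eq_some_iff.1 h
      exact ⟨⟨t, (List.isChain_cons.1 hl).2⟩, ⟨a, Or.inr rfl⟩, rfl⟩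
    · refine ⟨⟨a :: l, List.isChain_cons.2 ⟨?_, hl⟩⟩, ⟨a, Or.inl rfl⟩, rfl⟩
      rintro b hb rfl
      exact h hb

instance regularTree_locallyFinite (d : ℕ) : (regularTree d).LocallyFinite := fun u =>
  ((Set.finite_range _).subset (regularTree_neighborSet d u).subset
    |>.of_finite_image Subtype.val_injective.injOn).fintype

theorem regularTree_degree (d : ℕ) : (regularTree d).IsRegularOfDegree d := by
  intro u
  rw [← SimpleGraph.card_neighborSet_eq_degree, ← Nat.card_eq_fintype_card,
    ← Nat.card_image_of_injective Subtype.val_injective, regularTree_neighborSet,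
    Nat.card_range_of_injective, Nat.card_eq_fintype_card, Fintype.card_fin]
  obtain ⟨l, hl⟩ := u
  intro a b hab
  simp only at hab
  split_ifs at hab with h1 h2 h2
  · exact Option.some_injective _ (h1.symm.trans h2)
  · have := congrArg List.length hab
    simp at this
  · have := congrArg List.length hab
    simp at this
    omega
  · exact (List.cons.inj hab).1

theorem regularTree_isTree (d : ℕ) : (regularTree d).IsTree := by
  have hroot : ∀ u : TreeVertex d, (regularTree d).Reachable u (treeRoot d) := by
    rintro ⟨l, hl⟩
    induction l with
    | nil => exact SimpleGraph.Reachable.refl _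
    | cons a l ih =>
      have hadj : (regularTree d).Adj ⟨a :: l, hl⟩ ⟨l, (List.isChain_cons.1 hl).2⟩ :=
        ⟨a, Or.inr rfl⟩
      exact hadj.reachable.trans (ih _)
  have : Nonempty (TreeVertex d) := ⟨treeRoot d⟩
  refine ⟨⟨fun u v => (hroot u).trans (hroot v).symm⟩, ?_⟩
  have key : ∀ (u v : TreeVertex d) (a : Fin d), v.1 = a :: u.1 →
      (regularTree d).IsBridge s(u, v) := by
    intro u v a hv
    rw [SimpleGraph.isBridge_iff]
    rintro ⟨p⟩
    have inv : ∀ x y : TreeVertex d, ((regularTree d).deleteEdges {s(u, v)}).Adj x y →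
        v.1 <:+ x.1 → v.1 <:+ y.1 := by
      rintro x y hxy hx
      rw [SimpleGraph.deleteEdges_adj] at hxy
      obtain ⟨⟨b, h | h⟩, hne⟩ := hxy
      · rw [h]
        exact hx.trans (List.suffix_cons _ _)
      · rw [h, List.suffix_cons_iff] at hx
        rcases hx with hx | hx
        · exfalso
          rw [hv] at hx
          have hy : u = y := Subtype.ext (List.cons.inj hx).2
          have hx' : v = x := Subtype.ext (by rw [hv, hx, h])
          subst hy hx'
          exact hne (Sym2.eq_swap)
        · exact hx
    have hwalk : ∀ x y : TreeVertex d, ((regularTree d).deleteEdges {s(u, v)}).Walk x y →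
        v.1 <:+ x.1 → v.1 <:+ y.1 := by
      intro x y q
      induction q with
      | nil => exact id
      | cons hxy _ ih => exact fun hx => ih (inv _ _ hxy hx)
    have := (hwalk _ _ p.reverse (List.suffix_refl _)).length_le
    rw [hv] at this
    simp at this
  rw [SimpleGraph.isAcyclic_iff_forall_adj_isBridge]
  rintro u v ⟨a, h | h⟩
  · exact key u v a h
  · rw [Sym2.eq_swap]
    exact key v u a h

/-- The degree `d` star in `T_d` with center `o`: the vertex `o` together with its neighbors. -/
def treeStar (d : ℕ) (o : TreeVertex d) : Finset (TreeVertex d) :=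
  insert o ((regularTree d).neighborFinset o)

/-! ### Rooted colored graphs and their neighborhoods -/

/-- A rooted graph with an `S`-coloring of its vertices. -/
structure RootedColoredGraph (S : Type*) where
  V : Type
  graph : SimpleGraph V
  root : V
  color : V → S

/-- Isomorphism of rooted `S`-colored graphs. -/
def RootedColoredGraph.IsIso {S : Type*} (H K : RootedColoredGraph S) : Prop :=
  ∃ e : H.graph ≃g K.graph, e H.root = K.root ∧ ∀ v, K.color (e v) = H.color v

/-- The neighborhood `N_r(v)` of radius `r` of `v` in `G`: the subgraph induced on the vertices at
distance at most `r` from `v`, rooted at `v` and with the restriction of the coloring `f`. -/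
def neighborhood {S : Type*} {V : Type} (G : SimpleGraph V) (f : V → S) (v : V) (r : ℕ) :
    RootedColoredGraph S where
  V := {w : V // G.edist v w ≤ r}
  graph := G.induce {w : V | G.edist v w ≤ r}
  root := ⟨v, by simp⟩
  color := fun w => f w.1

/-- The probability that a uniformly random element of `Fin n` satisfies `P`. -/
def vertexProb (n : ℕ) (P : Fin n → Prop) : ℝ :=
  ({v : Fin n | P v}.ncard : ℝ) / n

/-! ### Graph sequences, invariant processes and typical processes -/

/-- A sequence of finite graphs is a large girth sequence if for every `ε > 0`, for all but finitely
many `i`, the probability that a random vertex of `G i` is contained in a cycle of length at most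
`⌈1/ε⌉` is at most `ε`. -/
def IsLargeGirth (n : ℕ → ℕ) (G : ∀ i, SimpleGraph (Fin (n i))) : Prop :=
  ∀ ε : ℝ, 0 < ε → ∃ N : ℕ, ∀ i, N ≤ i →
    vertexProb (n i) (fun v => ∃ p : (G i).Walk v v, p.IsCycle ∧ p.length ≤ ⌈1 / ε⌉₊) ≤ ε

/-- A random `S`-coloring `μ` of the tree `T_d` is invariant under all automorphisms of `T_d`; an
automorphism `φ` moves the label of `φ⁻¹ v` to `v`. -/
def IsInvariantProcess {S : Type*} [MeasurableSpace S] (d : ℕ) (μ : Measure (TreeVertex d → S)) :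
    Prop :=
  ∀ φ : regularTree d ≃g regularTree d, μ.map (fun x v => x (φ.symm v)) = μ

/-- The colored graphs `(G i, f i)` converge in the Benjamini--Schramm sense to the random coloring
`μ` of the rooted tree: for every `r`, the law of the isomorphism class of the colored neighborhood
of radius `r` of a random vertex of `G i` converges to the law of the isomorphism class of the
`μ`-random colored neighborhood of radius `r` of the root of the tree. -/
def IsBSLimit {S : Type*} [MeasurableSpace S] (d : ℕ) (n : ℕ → ℕ)
    (G : ∀ i, SimpleGraph (Fin (n i))) (f : ∀ i, Fin (n i) → S)
    (μ : Measure (TreeVertex d → S)) : Prop :=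
  ∀ (r : ℕ) (H : RootedColoredGraph S),
    Tendsto (fun i => vertexProb (n i) fun v => (neighborhood (G i) (f i) v r).IsIso H) atTop
      (𝓝 (μ.real {x | (neighborhood (regularTree d) x (treeRoot d) r).IsIso H}))

/-- `μ ∈ [{G i}]_S`: the sequence `G i` is a large girth sequence, and `μ` is an invariant process
that arises as the Benjamini--Schramm limit of `S`-colorings of the graphs `G i`. -/
def MemProfile {S : Type*} [MeasurableSpace S] (d : ℕ) (n : ℕ → ℕ)
    (G : ∀ i, SimpleGraph (Fin (n i))) (μ : Measure (TreeVertex d → S)) : Prop :=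
  IsLargeGirth n G ∧ IsProbabilityMeasure μ ∧ IsInvariantProcess d μ ∧
    ∃ f : ∀ i, Fin (n i) → S, IsBSLimit d n G f μ

/-- The `d`-regular (simple, labeled) graphs on `n` vertices. -/
def RegularGraphOn (d n : ℕ) : Type :=
  {G : SimpleGraph (Fin n) // ∀ v, (G.neighborSet v).ncard = d}

instance (d n : ℕ) : MeasurableSpace (RegularGraphOn d n) := ⊤

instance (d n : ℕ) : Finite (RegularGraphOn d n) :=
  inferInstanceAs (Finite {G : SimpleGraph (Fin n) // ∀ v, (G.neighborSet v).ncard = d})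

/-- The law of a uniformly random `d`-regular graph on `n` vertices (for those `d`, `n` for which
such graphs exist). -/
def uniformRegularGraph (d n : ℕ) : Measure (RegularGraphOn d n) :=
  ProbabilityTheory.uniformOn Set.univ

/-- `μ` is a typical process with values in the finite set `S`: there is a fixed sequence `n i` of
sizes (for which `d`-regular graphs on `n i` vertices exist) such that with probability one
`μ ∈ [{G i}]`, where the `G i` are independent uniformly random `d`-regular graphs on `n i`
vertices. -/
def IsTypical {S : Type*} [MeasurableSpace S] (d : ℕ) (μ : Measure (TreeVertex d → S)) : Prop :=
  ∃ n : ℕ → ℕ, (∀ i, 0 < n i ∧ Nonempty (RegularGraphOn d (n i))) ∧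
    ∀ᵐ G ∂(Measure.infinitePi fun i => uniformRegularGraph d (n i)),
      MemProfile d n (fun i => (G i).1) μ

/-! ### Entropy, total correlation, total variation distance -/

/-- The entropy (with natural logarithm) of a probability distribution on a finite set. -/
def shannonEntropy {A : Type*} [Fintype A] [MeasurableSpace A] (P : Measure A) : ℝ :=
  ∑ a, Real.negMulLog (P.real {a})

/-- The marginal distribution `μ_F` of a process on a finite set `F` of vertices. -/
def marginal {S V : Type*} [MeasurableSpace S] (μ : Measure (V → S)) (F : Finset V) :
    Measure (F → S) :=
  μ.map F.restrict

/-- The product measure `ν_F` of the marginals of `μ_F`. -/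
def productMarginal {S V : Type*} [MeasurableSpace S] (μ : Measure (V → S)) (F : Finset V) :
    Measure (F → S) :=
  Measure.pi fun v : F => (marginal μ F).map fun x => x v

/-- The configuration entropy `h(F)`. -/
def configEntropy {S V : Type*} [Fintype S] [DecidableEq V] [MeasurableSpace S]
    (μ : Measure (V → S)) (F : Finset V) : ℝ :=
  shannonEntropy (marginal μ F)

/-- The total correlation `t(F) = h(ν_F) - h(F)`. -/
def totalCorrelation {S V : Type*} [Fintype S] [DecidableEq V] [MeasurableSpace S]
    (μ : Measure (V → S)) (F : Finset V) : ℝ :=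
  shannonEntropy (productMarginal μ F) - configEntropy μ F

/-- The total variation distance `sup_A |P(A) - Q(A)|` of two probability measures. -/
def tvDist {A : Type*} [MeasurableSpace A] (P Q : Measure A) : ℝ :=
  ⨆ B : {B : Set A // MeasurableSet B}, |P.real B.1 - Q.real B.1|

end

/-! Write h(v) and h(e) for the entropies of a vertex and of an edge; by invariance they do not
depend on the vertex or edge. Let C' be the star without the leaf. Three inequalities combine
linearly. The star-edge inequality (d/2) h(e) ≤ h(C) is `IsTypical.star_edge_inequality`.
Submodularity gives h(C') ≤ h(v) + (d-1)(h(e) - h(v)), which is `configEntropy_insert_le`. The third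
is the assumption h(C) - h(C') ≤ b. Eliminating h(C) and h(e) bounds t(C') = d h(v) - h(C'). Since
t(C') is the relative entropy of the marginal with respect to the product of its marginals,
Pinsker's inequality (`tvDist_le_sqrt_totalCorrelation`) gives the bound on the distance.

The substance is the star-edge inequality, a first moment estimate in the configuration model, where
a random pairing of the half-edges `Fin n × Fin d` replaces the random graph. A coloring close to
the process assigns to each vertex the colors of its star. Up to subexponential factors there are at
most exp(n h(C)) such words of star types (`card_filter_sum_neg_log_le`). A word labels each
half-edge with an ordered pair of colors, and a pairing must match opposite labels. A proportion of
at most about exp(-(nd/2) h(e)) of all pairings does so (`card_compatible_pairings_le`). If the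
inequality failed, a union bound (`card_exists_coloring_le`) would make such colorings exponentially
unlikely.

The estimate passes to simple graphs because each regular graph arises from exactly (d!)^n pairings
(`ncard_mul_card_simplePairings_le`) and because switchings show that the proportion of simple
pairings is at least inverse polynomial in n (`card_pairings_le_simplePairings`); the exponential
gain absorbs this loss. Conversely, Benjamini--Schramm convergence at radius one makes almost every
sequence eventually consist of graphs with such colorings (`eventually_mem_goodGraphs`), a
contradiction. -/

noncomputable section

/-! ### Entropy of finitely valued random variables -/

/-- Gibbs' inequality. -/
theorem sum_mul_log_sub_log_nonneg {A : Type*} [Fintype A] (p q : A → ℝ) (hp : ∀ a, 0 ≤ p a)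
    (hq : ∀ a, 0 ≤ q a) (hpq : ∀ a, q a = 0 → p a = 0) (hsum : ∑ a, q a ≤ ∑ a, p a) :
    0 ≤ ∑ a, p a * (Real.log (p a) - Real.log (q a)) := by
  have key : ∀ a, p a - q a ≤ p a * (Real.log (p a) - Real.log (q a)) := by
    intro a
    rcases (hp a).eq_or_lt with h | h
    · simp [← h, hq a]
    · have hqa : 0 < q a := (hq a).lt_of_ne fun h0 => h.ne' (hpq a h0.symm)
      have h1 := Real.log_le_sub_one_of_pos (div_pos hqa h)
      rw [Real.log_div hqa.ne' h.ne'] at h1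
      have h2 : p a * (q a / p a - 1) = q a - p a := by field_simp
      nlinarith [mul_le_mul_of_nonneg_left h1 h.le]
  calc (0 : ℝ) ≤ ∑ a, (p a - q a) := by rw [Finset.sum_sub_distrib]; linarith
    _ ≤ _ := Finset.sum_le_sum fun a _ => key a

/-- Gibbs' inequality for `p` against the distribution with the same (A,C) and (B,C) marginals under
which A and B are conditionally independent given C. The difference of the two sides is the
conditional mutual information. -/
theorem sum_negMulLog_submodular {A B C : Type*} [Fintype A] [Fintype B] [Fintype C]
    (p : A → B → C → ℝ) (hp : ∀ a b c, 0 ≤ p a b c) :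
    ∑ a, ∑ b, ∑ c, Real.negMulLog (p a b c) + ∑ c, Real.negMulLog (∑ a, ∑ b, p a b c) ≤
      ∑ a, ∑ c, Real.negMulLog (∑ b, p a b c) + ∑ b, ∑ c, Real.negMulLog (∑ a, p a b c) := by
  set pAC : A → C → ℝ := fun a c => ∑ b, p a b c with hAC
  set pBC : B → C → ℝ := fun b c => ∑ a, p a b c with hBC
  set pC : C → ℝ := fun c => ∑ a, ∑ b, p a b c with hC
  have nAC : ∀ a c, 0 ≤ pAC a c := fun a c => Finset.sum_nonneg fun b _ => hp a b c
  have nBC : ∀ b c, 0 ≤ pBC b c := fun b c => Finset.sum_nonneg fun a _ => hp a b c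
  have nC : ∀ c, 0 ≤ pC c := fun c => Finset.sum_nonneg fun a _ => nAC a c
  have leAC : ∀ a b c, p a b c ≤ pAC a c := fun a b c =>
    Finset.single_le_sum (f := fun b => p a b c) (fun b _ => hp a b c) (Finset.mem_univ b)
  have leBC : ∀ a b c, p a b c ≤ pBC b c := fun a b c =>
    Finset.single_le_sum (f := fun a => p a b c) (fun a _ => hp a b c) (Finset.mem_univ a)
  have leC : ∀ a b c, p a b c ≤ pC c := fun a b c => (leAC a b c).trans
    (Finset.single_le_sum (f := fun a => pAC a c) (fun a _ => nAC a c) (Finset.mem_univ a))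
  have sumBC : ∀ c, ∑ b, pBC b c = pC c := fun c => Finset.sum_comm
  have sumAC : ∀ c, ∑ a, pAC a c = pC c := fun c => rfl
  have gibbs := sum_mul_log_sub_log_nonneg (A := A × B × C) (fun t => p t.1 t.2.1 t.2.2)
    (fun t => pAC t.1 t.2.2 * pBC t.2.1 t.2.2 / pC t.2.2) (fun t => hp _ _ _)
    (fun t => div_nonneg (mul_nonneg (nAC _ _) (nBC _ _)) (nC _)) ?_ ?_
  -- The logarithm splits only where all marginals are positive; where `p` vanishes both sides are
  -- zero.
  · have expand : ∀ a b c, p a b c *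
        (Real.log (p a b c) - Real.log (pAC a c * pBC b c / pC c)) =
        p a b c * Real.log (p a b c) - p a b c * Real.log (pAC a c)
          - p a b c * Real.log (pBC b c) + p a b c * Real.log (pC c) := by
      intro a b c
      rcases (hp a b c).eq_or_lt with h | h
      · simp [← h]
      · rw [Real.log_div (mul_pos (h.trans_le (leAC a b c)) (h.trans_le (leBC a b c))).ne'
          (h.trans_le (leC a b c)).ne', Real.log_mul (h.trans_le (leAC a b c)).ne'
          (h.trans_le (leBC a b c)).ne']
        ring
    simp only [Fintype.sum_prod_type, expand, Finset.sum_add_distrib, Finset.sum_sub_distrib]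
      at gibbs
    have e1 : ∑ a, ∑ b, ∑ c, p a b c * Real.log (pAC a c) =
        ∑ a, ∑ c, pAC a c * Real.log (pAC a c) := by
      refine Finset.sum_congr rfl fun a _ => ?_
      rw [Finset.sum_comm]
      exact Finset.sum_congr rfl fun c _ => by rw [← Finset.sum_mul]
    have e2 : ∑ a, ∑ b, ∑ c, p a b c * Real.log (pBC b c) =
        ∑ b, ∑ c, pBC b c * Real.log (pBC b c) := by
      rw [Finset.sum_comm]
      refine Finset.sum_congr rfl fun b _ => ?_
      rw [Finset.sum_comm]
      exact Finset.sum_congr rfl fun c _ => by rw [← Finset.sum_mul]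
    have e3 : ∑ a, ∑ b, ∑ c, p a b c * Real.log (pC c) = ∑ c, pC c * Real.log (pC c) := by
      have : ∀ a, ∑ b, ∑ c, p a b c * Real.log (pC c) = ∑ c, pAC a c * Real.log (pC c) := by
        intro a
        rw [Finset.sum_comm]
        exact Finset.sum_congr rfl fun c _ => by rw [← Finset.sum_mul]
      simp only [this]
      rw [Finset.sum_comm]
      exact Finset.sum_congr rfl fun c _ => by rw [← Finset.sum_mul]
    rw [e1, e2, e3] at gibbs
    simp only [Real.negMulLog, neg_mul, Finset.sum_neg_distrib]
    linarith
  · intro t h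
    rcases div_eq_zero_iff.1 h with h | h
    · rcases mul_eq_zero.1 h with h | h
      · exact le_antisymm (h ▸ leAC _ _ _) (hp _ _ _)
      · exact le_antisymm (h ▸ leBC _ _ _) (hp _ _ _)
    · exact le_antisymm (h ▸ leC _ _ _) (hp _ _ _)
  · simp only [Fintype.sum_prod_type]
    have e1 : ∑ a, ∑ b, ∑ c, pAC a c * pBC b c / pC c = ∑ c, pC c := by
      have : ∀ a, ∑ b, ∑ c, pAC a c * pBC b c / pC c = ∑ c, pAC a c := by
        intro a
        rw [Finset.sum_comm]
        refine Finset.sum_congr rfl fun c _ => ?_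
        rw [← Finset.sum_div, ← Finset.mul_sum, sumBC]
        rcases (nC c).eq_or_lt with h | h
        · rw [← h]
          have : pAC a c ≤ pC c := Finset.single_le_sum (f := fun a => pAC a c)
            (fun a _ => nAC a c) (Finset.mem_univ a)
          have := le_antisymm (h ▸ this) (nAC a c)
          simp [this]
        · field_simp
      simp only [this]
      rw [Finset.sum_comm]
    rw [e1]
    apply le_of_eq
    rw [show ∑ c, pC c = ∑ c, ∑ a, pAC a c from rfl, Finset.sum_comm]
    refine Finset.sum_congr rfl fun a _ => ?_
    rw [show ∑ c, pAC a c = ∑ c, ∑ b, p a b c from rfl, Finset.sum_comm]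

/-- The entropy of a finitely valued random variable. -/
def varEntropy {Ω A : Type*} [MeasurableSpace Ω] [Fintype A] (μ : Measure Ω) (X : Ω → A) : ℝ :=
  ∑ a, Real.negMulLog (μ.real (X ⁻¹' {a}))

section varEntropy

variable {Ω A B C : Type*} [MeasurableSpace Ω] [Fintype A] [Fintype B] [Fintype C]

/-- Random variables that determine each other have the same entropy. -/
theorem varEntropy_congr (μ : Measure Ω) (X : Ω → A) (Y : Ω → B)
    (h : ∀ ω ω', X ω = X ω' ↔ Y ω = Y ω') : varEntropy μ X = varEntropy μ Y := by
  have hXY : ∀ ω, X ⁻¹' {X ω} = Y ⁻¹' {Y ω} := fun ω => Set.ext fun ω' => h ω' ω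
  have hex : ∀ a, Real.negMulLog (μ.real (X ⁻¹' {a})) ≠ 0 → ∃ ω, X ω = a := by
    intro a ha
    by_contra! hne
    apply ha
    rw [show X ⁻¹' {a} = ∅ from Set.eq_empty_of_forall_notMem fun ω hω => hne ω hω]
    simp
  have hey : ∀ b, Real.negMulLog (μ.real (Y ⁻¹' {b})) ≠ 0 → ∃ ω, Y ω = b := by
    intro b hb
    by_contra! hne
    apply hb
    rw [show Y ⁻¹' {b} = ∅ from Set.eq_empty_of_forall_notMem fun ω hω => hne ω hω]
    simp
  -- Values that are never attained contribute zero, so only attained values have to be matched,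
  -- through a common sample point.
  refine Finset.sum_bij_ne_zero (fun a _ ha => Y (hex a ha).choose)
    (fun _ _ _ => Finset.mem_univ _) ?_ ?_ ?_
  · intro a _ ha a' _ ha' heq
    rw [← (hex a ha).choose_spec, ← (hex a' ha').choose_spec]
    exact (h _ _).2 heq
  · intro b _ hb
    obtain ⟨ω, rfl⟩ := hey b hb
    have ha : Real.negMulLog (μ.real (X ⁻¹' {X ω})) ≠ 0 := by rwa [hXY]
    exact ⟨X ω, Finset.mem_univ _, ha, (h _ _).1 (hex _ ha).choose_spec⟩
  · intro a _ ha
    rw [← hXY, (hex a ha).choose_spec]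

theorem measureReal_eq_sum_preimage (μ : Measure Ω) [IsFiniteMeasure μ] (X : Ω → A)
    (hX : ∀ a, MeasurableSet (X ⁻¹' {a})) (s : Set Ω) :
    μ.real s = ∑ a, μ.real (s ∩ X ⁻¹' {a}) := by
  have h := measureReal_biUnion_finset (μ := μ.restrict s) (s := Finset.univ)
    (f := fun a => X ⁻¹' {a}) (fun a _ b _ hab => by
      refine Set.disjoint_left.2 fun x hx hx' => hab ?_
      rw [Set.mem_preimage, Set.mem_singleton_iff] at hx hx'
      exact hx.symm.trans hx') (fun a _ => hX a)
  have h2 : (⋃ a ∈ (Finset.univ : Finset A), X ⁻¹' {a}) = Set.univ := by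
    ext x
    simp
  rw [h2, measureReal_restrict_apply MeasurableSet.univ, Set.univ_inter] at h
  rw [h]
  exact Finset.sum_congr rfl fun a _ => by
    rw [measureReal_restrict_apply (hX a), Set.inter_comm]

theorem varEntropy_submodular (μ : Measure Ω) [IsFiniteMeasure μ] (X : Ω → A) (Y : Ω → B)
    (Z : Ω → C) (hX : ∀ a, MeasurableSet (X ⁻¹' {a})) (hY : ∀ a, MeasurableSet (Y ⁻¹' {a})) :
    varEntropy μ (fun ω => (X ω, Y ω, Z ω)) + varEntropy μ Z ≤
      varEntropy μ (fun ω => (X ω, Z ω)) + varEntropy μ (fun ω => (Y ω, Z ω)) := by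
  have h := sum_negMulLog_submodular
    (fun a b c => μ.real ((fun ω => (X ω, Y ω, Z ω)) ⁻¹' {(a, b, c)}))
    (fun _ _ _ => measureReal_nonneg)
  have hBC : ∀ b c, ∑ a, μ.real ((fun ω => (X ω, Y ω, Z ω)) ⁻¹' {(a, b, c)}) =
      μ.real ((fun ω => (Y ω, Z ω)) ⁻¹' {(b, c)}) := by
    intro b c
    rw [measureReal_eq_sum_preimage μ X hX]
    refine Finset.sum_congr rfl fun a _ => ?_
    congr 1
    ext ω
    simp [and_comm]
  have hAC : ∀ a c, ∑ b, μ.real ((fun ω => (X ω, Y ω, Z ω)) ⁻¹' {(a, b, c)}) =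
      μ.real ((fun ω => (X ω, Z ω)) ⁻¹' {(a, c)}) := by
    intro a c
    rw [measureReal_eq_sum_preimage μ Y hY ((fun ω => (X ω, Z ω)) ⁻¹' {(a, c)})]
    refine Finset.sum_congr rfl fun b _ => ?_
    congr 1
    ext ω
    simp only [Set.mem_preimage, Set.mem_singleton_iff, Prod.mk.injEq, Set.mem_inter_iff]
    tauto
  have hC : ∀ c, ∑ a, ∑ b, μ.real ((fun ω => (X ω, Y ω, Z ω)) ⁻¹' {(a, b, c)}) =
      μ.real (Z ⁻¹' {c}) := by
    intro c
    simp only [hAC]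
    rw [measureReal_eq_sum_preimage μ X hX (Z ⁻¹' {c})]
    refine Finset.sum_congr rfl fun a _ => ?_
    congr 1
    ext ω
    simp [and_comm]
  simp only [hC, hBC] at h
  simp only [hAC] at h
  simpa only [varEntropy, Fintype.sum_prod_type] using h

end varEntropy

/-! ### Pinsker's inequality -/

/-- Hoeffding's lemma for an indicator: a variable in [0,1] is subgaussian with variance proxy 1/4,
whence the exponent t²/8. -/
theorem exp_indicator_le {A : Type*} [Fintype A] [MeasurableSpace A] [MeasurableSingletonClass A]
    (Q : Measure A) [IsProbabilityMeasure Q] (B : Set A) (t : ℝ) :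
    ∑ a, Q.real {a} * Real.exp (t * B.indicator 1 a) ≤ Real.exp (t * Q.real B + t ^ 2 / 8) := by
  have h := ProbabilityTheory.hasSubgaussianMGF_of_mem_Icc (μ := Q) (a := 0) (b := 1)
    (X := B.indicator 1) (measurable_of_finite _).aemeasurable
    (Eventually.of_forall fun a => by
      by_cases ha : a ∈ B <;> simp [ha])
  have h2 := h.mgf_le t
  have hB : ∫ a, B.indicator (1 : A → ℝ) a ∂Q = Q.real B :=
    integral_indicator_one (Set.toFinite B).measurableSet
  rw [hB, ProbabilityTheory.mgf, integral_fintype] at h2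
  · have h3 : ∑ a, Q.real {a} * Real.exp (t * B.indicator 1 a) = Real.exp (t * Q.real B) *
        ∑ a, Q.real {a} • Real.exp (t * (B.indicator 1 a - Q.real B)) := by
      rw [Finset.mul_sum]
      refine Finset.sum_congr rfl fun a _ => ?_
      rw [smul_eq_mul, mul_left_comm, ← Real.exp_add]
      congr 2
      ring
    rw [h3, Real.exp_add]
    refine mul_le_mul_of_nonneg_left (h2.trans (Real.exp_le_exp.2 (le_of_eq ?_))) (Real.exp_nonneg _)
    norm_num
    ring
  · exact Integrable.of_finite

/-- Pinsker's inequality on a finite set. -/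
theorem pinsker_finite {A : Type*} [Fintype A] [MeasurableSpace A] [MeasurableSingletonClass A]
    (P Q : Measure A) [IsProbabilityMeasure P] [IsProbabilityMeasure Q]
    (hac : ∀ a, Q.real {a} = 0 → P.real {a} = 0) (B : Set A) :
    2 * (P.real B - Q.real B) ^ 2 ≤
      ∑ a, P.real {a} * (Real.log (P.real {a}) - Real.log (Q.real {a})) := by
  -- Gibbs' inequality is applied with `Q` tilted exponentially along `B`. It bounds the relative
  -- entropy below by t(P(B) - Q(B)) - t²/8, and this `t` is the maximizer. The tilted weights have
  -- total mass at most one, which suffices.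
  set t : ℝ := 4 * (P.real B - Q.real B) with ht
  set q : A → ℝ := fun a => Q.real {a} * Real.exp (t * B.indicator 1 a) *
    Real.exp (-(t * Q.real B + t ^ 2 / 8)) with hq
  have sumP : ∑ a, P.real {a} = 1 := by simp
  have hPB : ∑ a, P.real {a} * B.indicator (1 : A → ℝ) a = P.real B := by
    have := integral_indicator_one (μ := P) (Set.toFinite B).measurableSet
    rw [integral_fintype Integrable.of_finite] at this
    simpa using this
  have g := sum_mul_log_sub_log_nonneg (fun a => P.real {a}) q (fun a => measureReal_nonneg)
    (fun a => by positivity) (fun a ha => hac a (by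
      simpa [hq, Real.exp_ne_zero] using ha)) (by
      rw [sumP, hq, ← Finset.sum_mul, Real.exp_neg]
      exact mul_inv_le_one_of_le₀ (exp_indicator_le Q B t) (Real.exp_nonneg _))
  have e : ∀ a, P.real {a} * (Real.log (P.real {a}) - Real.log (q a)) =
      P.real {a} * (Real.log (P.real {a}) - Real.log (Q.real {a})) -
        t * (P.real {a} * B.indicator (1 : A → ℝ) a) +
        P.real {a} * (t * Q.real B + t ^ 2 / 8) := by
    intro a
    by_cases h : Q.real {a} = 0
    · simp [hac a h]
    · rw [hq]
      simp only
      rw [Real.log_mul (mul_ne_zero h (Real.exp_ne_zero _)) (Real.exp_ne_zero _),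
        Real.log_mul h (Real.exp_ne_zero _), Real.log_exp, Real.log_exp]
      ring
  simp only [e, Finset.sum_add_distrib, Finset.sum_sub_distrib, ← Finset.mul_sum,
    ← Finset.sum_mul, sumP, hPB] at g
  rw [ht] at g
  nlinarith [g]

/-! ### Product measures -/

section product

variable {ι S : Type*} [Fintype ι] [DecidableEq ι] [Fintype S] [MeasurableSpace S] [MeasurableSingletonClass S]

theorem sum_real_mul_eval (P : Measure (ι → S)) [IsProbabilityMeasure P] (i : ι) (g : S → ℝ) :
    ∑ a, P.real {a} * g (a i) = ∑ s, (P.map fun x => x i).real {s} * g s := by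
  have h := integral_map (μ := P) (φ := fun x : ι → S => x i) (measurable_pi_apply i).aemeasurable
    (f := g) (measurable_of_finite g).aestronglyMeasurable
  have : IsProbabilityMeasure (P.map fun x => x i) :=
    Measure.isProbabilityMeasure_map (measurable_pi_apply i).aemeasurable
  rw [integral_fintype Integrable.of_finite, integral_fintype Integrable.of_finite] at h
  simpa using h.symm

variable (ν : ι → Measure S) [∀ i, IsProbabilityMeasure (ν i)]

/-- The logarithm of a product weight is a sum of functions of single coordinates, so its
expectation sees only the marginals of `P`. Taking `P` to be the product itself gives additivity of
entropy; taking `P` to be a joint law gives the cross term of its relative entropy. -/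
theorem sum_real_mul_log_pi (P : Measure (ι → S)) [IsProbabilityMeasure P]
    (hP : ∀ i, (P.map fun x => x i) = ν i) :
    (∀ a, (Measure.pi ν).real {a} = 0 → P.real {a} = 0) ∧
      ∑ a, P.real {a} * Real.log ((Measure.pi ν).real {a}) = - ∑ i, shannonEntropy (ν i) := by
  have hprod : ∀ a, (Measure.pi ν).real {a} = ∏ i, (ν i).real {a i} := by
    intro a
    simp [Measure.real, Measure.pi_singleton, ENNReal.toReal_prod]
  have hle : ∀ a i, P.real {a} ≤ (ν i).real {a i} := by
    intro a i
    rw [← hP i, map_measureReal_apply (measurable_pi_apply i) (measurableSet_singleton _)]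
    refine measureReal_mono ?_
    rintro _ rfl
    simp
  refine ⟨fun a ha => ?_, ?_⟩
  · rw [hprod] at ha
    obtain ⟨i, -, hi⟩ := Finset.prod_eq_zero_iff.1 ha
    exact le_antisymm (hi ▸ hle a i) measureReal_nonneg
  · have h1 : ∀ a, P.real {a} * Real.log ((Measure.pi ν).real {a}) =
        ∑ i, P.real {a} * Real.log ((ν i).real {a i}) := by
      intro a
      by_cases h : P.real {a} = 0
      · simp [h]
      · rw [hprod, Real.log_prod, Finset.mul_sum]
        intro i _ h0
        exact h (le_antisymm (h0 ▸ hle a i) measureReal_nonneg)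
    simp only [h1]
    rw [Finset.sum_comm, ← Finset.sum_neg_distrib]
    refine Finset.sum_congr rfl fun i _ => ?_
    rw [sum_real_mul_eval P i fun s => Real.log ((ν i).real {s}), hP i, shannonEntropy,
      ← Finset.sum_neg_distrib]
    refine Finset.sum_congr rfl fun s _ => ?_
    simp [Real.negMulLog]

theorem shannonEntropy_pi : shannonEntropy (Measure.pi ν) = ∑ i, shannonEntropy (ν i) := by
  have h := (sum_real_mul_log_pi ν (Measure.pi ν)
    fun i => (measurePreserving_eval ν i).map_eq).2
  rw [← neg_inj, ← h, shannonEntropy, ← Finset.sum_neg_distrib]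
  exact Finset.sum_congr rfl fun a _ => by simp [Real.negMulLog]

end product

/-! ### Automorphisms of the regular tree -/

variable {d : ℕ}

/-- The neighbor of `u` that belongs to the letter `i`. -/
def treeStep (i : Fin d) (u : TreeVertex d) : TreeVertex d :=
  ⟨if u.1.head? = some i then u.1.tail else i :: u.1, by
    split_ifs with h
    · exact u.2.tail
    · refine List.isChain_cons.2 ⟨?_, u.2⟩
      rintro b hb rfl
      exact h hb⟩

theorem treeStep_val (i : Fin d) (u : TreeVertex d) :
    (treeStep i u).1 = if u.1.head? = some i then u.1.tail else i :: u.1 := rfl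

theorem treeStep_of_cons (i : Fin d) (l : List (Fin d)) (h : (i :: l).IsChain (· ≠ ·)) :
    treeStep i ⟨i :: l, h⟩ = ⟨l, h.tail⟩ := by
  apply Subtype.ext
  simp [treeStep_val]

theorem cons_eq_treeStep (i : Fin d) (l : List (Fin d)) (h : (i :: l).IsChain (· ≠ ·)) :
    (⟨i :: l, h⟩ : TreeVertex d) = treeStep i ⟨l, h.tail⟩ := by
  apply Subtype.ext
  rw [treeStep_val, if_neg]
  intro h'
  exact (List.isChain_cons.1 h).1 i h' rfl

/-- Letters act as generators of order two: the tree is a Cayley graph of the free product of d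
groups of order two. -/
theorem treeStep_treeStep (i : Fin d) (u : TreeVertex d) : treeStep i (treeStep i u) = u := by
  obtain ⟨l, hl⟩ := u
  by_cases h : l.head? = some i
  · obtain ⟨t, rfl⟩ := List.head?_eq_some_iff.1 h
    rw [treeStep_of_cons, ← cons_eq_treeStep]
  · apply Subtype.ext
    rw [treeStep_val, treeStep_val, if_neg h]
    simp

theorem treeAdj_iff (u v : TreeVertex d) : (regularTree d).Adj u v ↔ ∃ i, treeStep i u = v := by
  constructor
  · rintro ⟨a, h | h⟩
    · obtain ⟨v, hv⟩ := v
      obtain rfl : v = a :: u.1 := h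
      exact ⟨a, (cons_eq_treeStep a u.1 hv).symm⟩
    · obtain ⟨u, hu⟩ := u
      obtain rfl : u = a :: v.1 := h
      exact ⟨a, treeStep_of_cons a v.1 hu⟩
  · rintro ⟨i, rfl⟩
    refine ⟨i, ?_⟩
    rw [treeStep_val]
    split_ifs with h
    · right
      obtain ⟨t, ht⟩ := List.head?_eq_some_iff.1 h
      rw [ht]
      rfl
    · exact Or.inl rfl

theorem treeStep_injective (u : TreeVertex d) : Function.Injective fun i => treeStep i u := by
  intro a b hab
  have hab := congrArg Subtype.val hab
  simp only [treeStep_val] at hab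
  split_ifs at hab with h1 h2 h2
  · exact Option.some_injective _ (h1.symm.trans h2)
  · have := congrArg List.length hab
    simp at this
  · have := congrArg List.length hab
    simp at this
    omega
  · exact (List.cons.inj hab).1

/-- The map of the tree that commutes with the steps up to a permutation of the letters and moves
the root to `o`. -/
def treeMap (π : Equiv.Perm (Fin d)) (o u : TreeVertex d) : TreeVertex d :=
  u.1.foldr (fun i => treeStep (π i)) o

theorem treeMap_root (π : Equiv.Perm (Fin d)) (o : TreeVertex d) :
    treeMap π o (treeRoot d) = o := rfl

theorem treeMap_treeStep (π : Equiv.Perm (Fin d)) (o : TreeVertex d) (i : Fin d)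
    (u : TreeVertex d) : treeMap π o (treeStep i u) = treeStep (π i) (treeMap π o u) := by
  unfold treeMap
  rw [treeStep_val]
  split_ifs with h
  · obtain ⟨t, ht⟩ := List.head?_eq_some_iff.1 h
    rw [ht]
    simp [treeStep_treeStep]
  · rfl

/-- Every vertex is reached from the root by steps, so a map that intertwines the steps is
determined by the image of the root. -/
theorem treeMap_unique (π : Equiv.Perm (Fin d)) (f : TreeVertex d → TreeVertex d)
    (hf : ∀ i u, f (treeStep i u) = treeStep (π i) (f u)) (u : TreeVertex d) :
    f u = treeMap π (f (treeRoot d)) u := by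
  obtain ⟨l, hl⟩ := u
  induction l with
  | nil => rfl
  | cons i l ih =>
    rw [cons_eq_treeStep, hf, treeMap_treeStep]
    exact congrArg _ (ih hl.tail)

theorem exists_treeMap_eq_root (π : Equiv.Perm (Fin d)) (o : TreeVertex d) :
    ∃ p, treeMap π p o = treeRoot d := by
  have key : ∀ (l : List (Fin d)) (hl : l.IsChain (· ≠ ·)),
      ∃ p : TreeVertex d, treeMap π p ⟨l, hl⟩ = treeRoot d := by
    intro l hl
    have : ∀ (l : List (Fin d)) (v : TreeVertex d), ∃ p : TreeVertex d,
        l.foldr (fun i => treeStep (π i)) p = v := by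
      intro l
      induction l with
      | nil => exact fun v => ⟨v, rfl⟩
      | cons i l ih =>
        intro v
        obtain ⟨p, hp⟩ := ih (treeStep (π i) v)
        exact ⟨p, by rw [List.foldr_cons, hp, treeStep_treeStep]⟩
    exact this l _
  exact key o.1 o.2

/-- The composite commutes with all steps, and `p` is chosen so that it fixes the root; by
uniqueness it is the identity. -/
theorem exists_leftInverse_treeMap (π : Equiv.Perm (Fin d)) (o : TreeVertex d) :
    ∃ p, ∀ u, treeMap π⁻¹ p (treeMap π o u) = u := by
  obtain ⟨p, hp⟩ := exists_treeMap_eq_root π⁻¹ o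
  refine ⟨p, fun u => ?_⟩
  have h1 := treeMap_unique 1 (fun u => treeMap π⁻¹ p (treeMap π o u)) (fun i u => by
    simp [treeMap_treeStep]) u
  have h2 := treeMap_unique 1 (fun u : TreeVertex d => u) (fun i u => rfl) u
  simp only [treeMap_root, hp] at h1 h2
  rw [h1, ← h2]

theorem treeMap_bijective (π : Equiv.Perm (Fin d)) (o : TreeVertex d) :
    Function.Bijective (treeMap π o) := by
  obtain ⟨p, hp⟩ := exists_leftInverse_treeMap π o
  -- The left inverse has a left inverse of its own, which must coincide with the original map; this
  -- gives surjectivity.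
  obtain ⟨q, hq⟩ := exists_leftInverse_treeMap π⁻¹ p
  rw [inv_inv] at hq
  refine ⟨Function.LeftInverse.injective hp, fun v => ⟨treeMap π⁻¹ p v, ?_⟩⟩
  have h : treeMap π q = treeMap π o := by
    funext u
    have := hq (treeMap π o u)
    rwa [hp] at this
  rw [← h, hq]

/-- The automorphism of the regular tree given by `treeMap`. -/
def treeAut (π : Equiv.Perm (Fin d)) (o : TreeVertex d) : regularTree d ≃g regularTree d where
  toEquiv := Equiv.ofBijective _ (treeMap_bijective π o)
  map_rel_iff' := by
    intro u v
    simp only [Equiv.ofBijective_apply, treeAdj_iff]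
    constructor
    · rintro ⟨i, hi⟩
      refine ⟨π⁻¹ i, (treeMap_bijective π o).1 ?_⟩
      rw [treeMap_treeStep, ← hi]
      simp
    · rintro ⟨i, rfl⟩
      exact ⟨π i, (treeMap_treeStep π o i u).symm⟩

theorem treeAut_apply (π : Equiv.Perm (Fin d)) (o u : TreeVertex d) :
    treeAut π o u = treeMap π o u := rfl

/-! ### The law of the star around a vertex -/

section starLaw

variable {S : Type*} [Fintype S] [MeasurableSpace S] [MeasurableSingletonClass S]

/-- The colors of `o` and of its neighbors. -/
def starColors (o : TreeVertex d) (x : TreeVertex d → S) : S × (Fin d → S) :=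
  (x o, fun i => x (treeStep i o))

theorem measurableSet_starColors_preimage (o : TreeVertex d) (A : Set (S × (Fin d → S))) :
    MeasurableSet (starColors o ⁻¹' A) := by
  have hm : Measurable (starColors (S := S) o) :=
    (measurable_pi_apply o).prodMk (measurable_pi_lambda _ fun i => measurable_pi_apply _)
  exact hm (Set.toFinite A).measurableSet

/-- The law of the colors of the star around the root. -/
def starLaw (μ : Measure (TreeVertex d → S)) (t : S × (Fin d → S)) : ℝ :=
  μ.real (starColors (treeRoot d) ⁻¹' {t})

/-- The law of the colors of the endpoints of an edge that is given by the letter `i`. -/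
def edgeLaw (μ : Measure (TreeVertex d → S)) (i : Fin d) (p : S × S) : ℝ :=
  μ.real ((fun x => (x (treeRoot d), x (treeStep i (treeRoot d)))) ⁻¹' {p})

variable {μ : Measure (TreeVertex d → S)}

omit [Fintype S] [MeasurableSingletonClass S] in
theorem IsInvariantProcess.real_preimage (hμ : IsInvariantProcess d μ)
    (φ : regularTree d ≃g regularTree d) {E : Set (TreeVertex d → S)} (hE : MeasurableSet E) :
    μ.real ((fun x v => x (φ v)) ⁻¹' E) = μ.real E := by
  have h := hμ φ.symm
  have hm : Measurable fun (x : TreeVertex d → S) v => x (φ v) :=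
    measurable_pi_lambda _ fun v => measurable_pi_apply _
  conv_rhs => rw [← h]
  rw [map_measureReal_apply (measurable_pi_lambda _ fun v => measurable_pi_apply _) hE]
  rfl

/-- The automorphism `treeAut π o` carries the root to `o` and its neighbor in direction `i` to the
one in direction `π i`. Varying `o` identifies the laws of all stars; varying `π` makes the leaves
exchangeable. -/
theorem real_starColors_preimage (hμ : IsInvariantProcess d μ) (π : Equiv.Perm (Fin d))
    (o : TreeVertex d) (t : S × (Fin d → S)) :
    μ.real ((fun x => (x o, fun i => x (treeStep (π i) o))) ⁻¹' {t}) = starLaw μ t := by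
  rw [starLaw, ← hμ.real_preimage (treeAut π o) (measurableSet_starColors_preimage _ _)]
  congr 1

theorem starLaw_perm (hμ : IsInvariantProcess d μ) (π : Equiv.Perm (Fin d))
    (t : S × (Fin d → S)) : starLaw μ (t.1, t.2 ∘ π) = starLaw μ t := by
  rw [← real_starColors_preimage hμ π⁻¹ (treeRoot d) t, starLaw]
  congr 1
  ext x
  simp only [starColors, Set.mem_preimage, Set.mem_singleton_iff, Prod.ext_iff, funext_iff,
    Function.comp]
  refine and_congr_right fun _ => ⟨fun h i => ?_, fun h i => ?_⟩
  · simpa using h (π⁻¹ i)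
  · simpa using h (π i)

theorem measurableSet_pair (u v : TreeVertex d) (A : Set (S × S)) :
    MeasurableSet ((fun x : TreeVertex d → S => (x u, x v)) ⁻¹' A) :=
  ((measurable_pi_apply u).prodMk (measurable_pi_apply v)) (Set.toFinite A).measurableSet

theorem real_pair_preimage (hμ : IsInvariantProcess d μ) (i j : Fin d) (o : TreeVertex d)
    (p : S × S) : μ.real ((fun x => (x o, x (treeStep j o))) ⁻¹' {p}) = edgeLaw μ i p := by
  rw [edgeLaw, ← hμ.real_preimage (treeAut (Equiv.swap i j) o)
    (measurableSet_pair (treeRoot d) (treeStep i (treeRoot d)) {p})]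
  congr 1
  ext x
  simp [treeAut_apply, treeMap_treeStep, treeMap_root]

omit [Fintype S] in
theorem real_single_preimage (hμ : IsInvariantProcess d μ) (o : TreeVertex d) (s : S) :
    μ.real ((fun x => x o) ⁻¹' {s}) = μ.real ((fun x => x (treeRoot d)) ⁻¹' {s}) := by
  rw [← hμ.real_preimage (treeAut 1 o)
    ((measurable_pi_apply (treeRoot d)) (measurableSet_singleton s))]
  rfl

end starLaw

/-! ### Pairings -/

section pairings

variable {X : Type*} [Fintype X] [DecidableEq X]

/-- A permutation is a pairing if it is an involution without fixed points. -/
def IsPairing (σ : Equiv.Perm X) : Prop := (∀ x, σ (σ x) = x) ∧ ∀ x, σ x ≠ x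

omit [Fintype X] [DecidableEq X] in
theorem IsPairing.conj {σ : Equiv.Perm X} (h : IsPairing σ) (g : Equiv.Perm X) :
    IsPairing (g * σ * g⁻¹) := by
  refine ⟨fun x => by simp [h.1], fun x hx => h.2 (g⁻¹ x) ?_⟩
  apply g.injective
  simpa using hx

open scoped Classical in
variable (X) in
/-- The finite set of all pairings. -/
def pairings : Finset (Equiv.Perm X) := {σ | IsPairing σ}

theorem mem_pairings {σ : Equiv.Perm X} : σ ∈ pairings X ↔ IsPairing σ := by
  simp [pairings]

/-- In a family of permutations that is closed under conjugation by transpositions of points of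
`Y`, all points of `Y` are equally likely images of a point `x` outside `Y`. -/
theorem card_mul_card_filter_le (U : Finset (Equiv.Perm X)) (Y : Finset X) (x : X) (hx : x ∉ Y)
    (hU : ∀ σ ∈ U, ∀ y ∈ Y, ∀ z ∈ Y, Equiv.swap y z * σ * (Equiv.swap y z)⁻¹ ∈ U)
    (y : X) (hy : y ∈ Y) : Y.card * (U.filter fun σ => σ x = y).card ≤ U.card := by
  have h1 : ∀ z ∈ Y, (U.filter fun σ => σ x = y).card ≤ (U.filter fun σ => σ x = z).card := by
    intro z hz
    refine Finset.card_le_card_of_injOn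
      (fun σ => Equiv.swap y z * σ * (Equiv.swap y z)⁻¹) ?_ ?_
    · intro σ hσ
      simp only [Finset.coe_filter, Set.mem_ofPred_eq] at hσ ⊢
      refine ⟨hU σ hσ.1 y hy z hz, ?_⟩
      have hxy : x ≠ y := fun h => hx (h ▸ hy)
      have hxz : x ≠ z := fun h => hx (h ▸ hz)
      simp [Equiv.swap_apply_of_ne_of_ne hxy hxz, hσ.2]
    · intro σ _ τ _ h
      simpa using h
  calc Y.card * (U.filter fun σ => σ x = y).card
      = ∑ z ∈ Y, (U.filter fun σ => σ x = y).card := by simp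
    _ ≤ ∑ z ∈ Y, (U.filter fun σ => σ x = z).card := Finset.sum_le_sum h1
    _ = (Y.biUnion fun z => U.filter fun σ => σ x = z).card := by
      rw [Finset.card_biUnion]
      intro z _ w _ hzw
      refine Finset.disjoint_left.2 fun σ h1 h2 => hzw ?_
      exact (Finset.mem_filter.1 h1).2.symm.trans (Finset.mem_filter.1 h2).2
    _ ≤ U.card := Finset.card_le_card (by simp)

theorem card_pairings_apply_eq_le (x y : X) :
    (Fintype.card X - 1) * ((pairings X).filter fun σ => σ x = y).card ≤ (pairings X).card := by
  by_cases hxy : y = x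
  · have : ((pairings X).filter fun σ => σ x = y) = ∅ := by
      refine Finset.filter_eq_empty_iff.2 fun σ hσ h => ?_
      exact (mem_pairings.1 hσ).2 x (h.trans hxy)
    simp [this]
  · have h := card_mul_card_filter_le (pairings X) {x}ᶜ x (by simp)
      (fun σ hσ y _ z _ => mem_pairings.2 ((mem_pairings.1 hσ).conj _)) y (by simpa using hxy)
    rwa [Finset.card_compl, Finset.card_singleton] at h

/-- Given that `x` is paired with `y`, conjugation by transpositions avoiding `x`, `y` and `x'`
preserves the condition, so the partner of `x'` is equidistributed over the remaining points, of
which there are at least |X| - 3. -/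
theorem card_pairings_apply_eq_apply_eq_le (x y x' y' : X) (hy : y' ≠ y)
    (hxy : x' ≠ y) : (Fintype.card X - 1) * ((Fintype.card X - 3) *
      ((pairings X).filter fun σ => σ x = y ∧ σ x' = y').card) ≤ (pairings X).card := by
  refine le_trans (Nat.mul_le_mul_left _ ?_) (card_pairings_apply_eq_le x y)
  rw [← Finset.filter_filter]
  by_cases hy'x : y' = x ∨ y' = x'
  · have : (((pairings X).filter fun σ => σ x = y).filter fun σ => σ x' = y') = ∅ := by
      refine Finset.filter_eq_empty_iff.2 fun σ hσ h => ?_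
      obtain ⟨h1, h2⟩ := Finset.mem_filter.1 hσ
      have h1 := mem_pairings.1 h1
      rcases hy'x with e | e
      · apply hxy
        rw [← h2, ← e, ← h, h1.1]
      · exact h1.2 x' (h.trans e)
    simp [this]
  · push Not at hy'x
    have h := card_mul_card_filter_le ((pairings X).filter fun σ => σ x = y) {x, y, x'}ᶜ x'
      (by simp) (fun σ hσ a ha b hb => by
        simp only [Finset.mem_compl, Finset.mem_insert, Finset.mem_singleton, not_or] at ha hb
        obtain ⟨h1, h2⟩ := Finset.mem_filter.1 hσ
        refine Finset.mem_filter.2 ⟨mem_pairings.2 ((mem_pairings.1 h1).conj _), ?_⟩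
        simp [Equiv.swap_apply_of_ne_of_ne (Ne.symm ha.1) (Ne.symm hb.1), h2,
          Equiv.swap_apply_of_ne_of_ne (Ne.symm ha.2.1) (Ne.symm hb.2.1)]) y'
      (by simp [hy, hy'x])
    refine le_trans (Nat.mul_le_mul_right _ ?_) h
    rw [Finset.card_compl]
    have := Finset.card_le_three (a := x) (b := y) (c := x')
    omega

end pairings

/-! ### Loops and multiple edges of pairings of half-edges -/

section badHalfEdges

variable {V K : Type*} [Fintype V] [DecidableEq V] [Fintype K] [DecidableEq K]

/-- The half-edge `x` belongs to a loop or to a multiple edge of the multigraph that is given by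
the pairing `σ`. -/
def IsBadHalfEdge (σ : Equiv.Perm (V × K)) (x : V × K) : Prop :=
  (σ x).1 = x.1 ∨ ∃ x', x' ≠ x ∧ x'.1 = x.1 ∧ (σ x').1 = (σ x).1

instance (σ : Equiv.Perm (V × K)) : DecidablePred (IsBadHalfEdge σ) := fun _ =>
  inferInstanceAs (Decidable (_ ∨ _))

/-- The set of half-edges in loops and multiple edges. -/
def badHalfEdges (σ : Equiv.Perm (V × K)) : Finset (V × K) := {x | IsBadHalfEdge σ x}

theorem mem_badHalfEdges {σ : Equiv.Perm (V × K)} {x : V × K} :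
    x ∈ badHalfEdges σ ↔ IsBadHalfEdge σ x := by
  simp [badHalfEdges]

/-- Splits bad half-edges into loops and parallel pairs, each expressed by prescribing one or two
values of `σ`, so that expectations follow from the pairing probabilities. -/
theorem card_badHalfEdges_le (σ : Equiv.Perm (V × K)) :
    (badHalfEdges σ).card ≤
      (∑ x : V × K, ∑ k : K, if σ x = (x.1, k) then 1 else 0) +
      ∑ x : V × K, ∑ y : V × K, ∑ k : K, ∑ l : K,
        if (x.1, k) ≠ x ∧ (y.1, l) ≠ y ∧ (x.1, k) ≠ y ∧ (σ x = y ∧ σ (x.1, k) = (y.1, l))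
          then 1 else 0 := by
  rw [badHalfEdges, Finset.card_filter, ← Finset.sum_add_distrib]
  refine Finset.sum_le_sum fun x _ => ?_
  split_ifs with h
  · by_cases hloop : (σ x).1 = x.1
    · refine le_add_right ?_
      refine le_trans ?_ (Finset.single_le_sum (fun _ _ => Nat.zero_le _)
        (Finset.mem_univ (σ x).2))
      rw [if_pos]
      rw [← hloop]
    · rcases h with h | ⟨x', h1, h2, h3⟩
      · exact absurd h hloop
      refine le_add_left ?_
      refine le_trans ?_ (Finset.single_le_sum (fun _ _ => Nat.zero_le _)
        (Finset.mem_univ (σ x)))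
      refine le_trans ?_ (Finset.single_le_sum (fun _ _ => Nat.zero_le _)
        (Finset.mem_univ x'.2))
      refine le_trans ?_ (Finset.single_le_sum (fun _ _ => Nat.zero_le _)
        (Finset.mem_univ (σ x').2))
      rw [← h2, ← h3, if_pos]
      refine ⟨h1, fun h => h1 (σ.injective h), ?_, rfl, rfl⟩
      intro h
      apply hloop
      rw [← h2, show x' = σ x from h]
  · exact Nat.zero_le _

variable (V K) in
theorem sum_card_badHalfEdges_le (hK : 0 < Fintype.card K) (h8 : 8 ≤ Fintype.card (V × K)) :
    ∑ σ ∈ pairings (V × K), (badHalfEdges σ).card ≤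
      4 * Fintype.card K ^ 2 * (pairings (V × K)).card := by
  set T := (pairings (V × K)).card with hT
  set M := Fintype.card (V × K) with hM
  set D := Fintype.card K with hD
  have h1 : (M - 1) * ∑ σ ∈ pairings (V × K), (∑ x : V × K, ∑ k : K,
      if σ x = (x.1, k) then 1 else 0) ≤ M * D * T := by
    rw [Finset.sum_comm, Finset.mul_sum]
    have : ∀ x : V × K, (M - 1) * ∑ σ ∈ pairings (V × K), (∑ k : K,
      if σ x = (x.1, k) then 1 else 0) ≤ D * T := by
      intro x
      rw [Finset.sum_comm, Finset.mul_sum]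
      refine (Finset.sum_le_card_nsmul _ _ T fun k _ => ?_).trans (by simp [hD])
      rw [← Finset.card_filter]
      exact card_pairings_apply_eq_le _ _
    refine (Finset.sum_le_card_nsmul _ _ (D * T) fun x _ => this x).trans ?_
    simp [hM, mul_assoc]
  have h2 : (M - 1) * ((M - 3) * ∑ σ ∈ pairings (V × K), ∑ x : V × K, ∑ y : V × K, ∑ k : K,
      ∑ l : K, if (x.1, k) ≠ x ∧ (y.1, l) ≠ y ∧ (x.1, k) ≠ y ∧ (σ x = y ∧ σ (x.1, k) = (y.1, l))
          then 1 else 0) ≤ M * M * (D * D) * T := by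
    rw [Finset.sum_comm, Finset.mul_sum, Finset.mul_sum]
    refine (Finset.sum_le_card_nsmul _ _ (M * (D * D) * T) fun x _ => ?_).trans
      (by simp [hM, mul_assoc])
    rw [Finset.sum_comm, Finset.mul_sum, Finset.mul_sum]
    refine (Finset.sum_le_card_nsmul _ _ (D * D * T) fun y _ => ?_).trans
      (by simp [hM, mul_assoc])
    rw [Finset.sum_comm, Finset.mul_sum, Finset.mul_sum]
    refine (Finset.sum_le_card_nsmul _ _ (D * T) fun k _ => ?_).trans
      (by simp [hD, mul_assoc])
    rw [Finset.sum_comm, Finset.mul_sum, Finset.mul_sum]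
    refine (Finset.sum_le_card_nsmul _ _ T fun l _ => ?_).trans (by simp [hD])
    rw [← Finset.card_filter]
    by_cases hc : (x.1, k) ≠ x ∧ (y.1, l) ≠ y ∧ (x.1, k) ≠ y
    · refine le_trans (Nat.mul_le_mul_left _ (Nat.mul_le_mul_left _ (Finset.card_le_card ?_)))
        (card_pairings_apply_eq_apply_eq_le x y (x.1, k) (y.1, l) hc.2.1 hc.2.2)
      intro σ hσ
      simp only [Finset.mem_filter] at hσ ⊢
      exact ⟨hσ.1, hσ.2.2.2.2⟩
    · rw [Finset.filter_false_of_mem]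
      · simp
      · exact fun σ _ h => hc ⟨h.1, h.2.1, h.2.2.1⟩
  have h3 := Finset.sum_le_sum fun σ (_ : σ ∈ pairings (V × K)) => card_badHalfEdges_le σ
  rw [Finset.sum_add_distrib] at h3
  refine h3.trans ?_
  set A := ∑ σ ∈ pairings (V × K), (∑ x : V × K, ∑ k : K, if σ x = (x.1, k) then 1 else 0)
  set B := ∑ σ ∈ pairings (V × K), ∑ x : V × K, ∑ y : V × K, ∑ k : K,
      ∑ l : K, if (x.1, k) ≠ x ∧ (y.1, l) ≠ y ∧ (x.1, k) ≠ y ∧ (σ x = y ∧ σ (x.1, k) = (y.1, l))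
          then 1 else 0
  clear_value A B T M D
  -- For M ≥ 8 one has M² ≤ 2(M - 1)(M - 3), so both expectations lose only a factor two; 8 is the
  -- first integer from which this holds.
  obtain ⟨m, rfl⟩ : ∃ m, M = m + 8 := ⟨M - 8, by omega⟩
  simp only [show m + 8 - 1 = m + 7 by omega, show m + 8 - 3 = m + 5 by omega] at h1 h2
  have hA : A ≤ 2 * (D * T) := by
    refine Nat.le_of_mul_le_mul_left (h1.trans ?_) (show 0 < m + 7 by omega)
    nlinarith [Nat.zero_le (D * T), Nat.zero_le (m * (D * T))]
  have hB : B ≤ 2 * (D * D * T) := by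
    refine Nat.le_of_mul_le_mul_left ?_ (show 0 < (m + 7) * (m + 5) by positivity)
    rw [mul_assoc]
    refine h2.trans ?_
    nlinarith [Nat.zero_le (D * D * T), Nat.zero_le (m * (D * D * T)),
      Nat.zero_le (m * m * (D * D * T))]
  have hD2 : D * T ≤ D * D * T := Nat.mul_le_mul_right _ (Nat.le_mul_of_pos_left _ hK)
  nlinarith

variable (V K) in
theorem card_pairings_le_two_mul (hK : 0 < Fintype.card K) (h8 : 8 ≤ Fintype.card (V × K)) :
    (pairings (V × K)).card ≤ 2 * ((pairings (V × K)).filter fun σ =>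
      (badHalfEdges σ).card ≤ 8 * Fintype.card K ^ 2).card := by
  have h := sum_card_badHalfEdges_le V K hK h8
  -- Markov's inequality: the threshold is twice the bound on the mean, so at most half of the
  -- pairings exceed it.
  have h1 : (8 * Fintype.card K ^ 2) * ((pairings (V × K)).filter fun σ =>
      ¬ (badHalfEdges σ).card ≤ 8 * Fintype.card K ^ 2).card ≤
      ∑ σ ∈ pairings (V × K), (badHalfEdges σ).card := by
    refine le_trans ?_ (Finset.sum_le_sum_of_subset (s := (pairings (V × K)).filter fun σ =>
      ¬ (badHalfEdges σ).card ≤ 8 * Fintype.card K ^ 2) (Finset.filter_subset _ _))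
    rw [mul_comm, ← smul_eq_mul]
    refine Finset.card_nsmul_le_sum _ _ _ fun σ hσ => ?_
    exact (not_le.1 (Finset.mem_filter.1 hσ).2).le
  have h2 := Finset.card_filter_add_card_filter_not (s := pairings (V × K))
    (fun σ => (badHalfEdges σ).card ≤ 8 * Fintype.card K ^ 2)
  have h3 := h1.trans h
  have h4 : 0 < 4 * Fintype.card K ^ 2 := by positivity
  have h5 : 2 * ((pairings (V × K)).filter fun σ =>
      ¬ (badHalfEdges σ).card ≤ 8 * Fintype.card K ^ 2).card ≤ (pairings (V × K)).card := by
    refine Nat.le_of_mul_le_mul_left ?_ h4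
    calc _ = _ := by ring
      _ ≤ _ := h3
  omega

omit [Fintype V] [DecidableEq V] [Fintype K] [DecidableEq K] in
theorem not_isBadHalfEdge_of_forall {τ : Equiv.Perm (V × K)} (hτ : IsPairing τ) {p q : V × K}
    (hpq : τ p = q) (h1 : p.1 ≠ q.1) (h2 : ∀ u, u ≠ p → u.1 = p.1 → (τ u).1 ≠ q.1) :
    ¬ IsBadHalfEdge τ p ∧ ¬ IsBadHalfEdge τ q := by
  subst hpq
  constructor
  · rintro (h | ⟨u, hu, hu1, hu2⟩)
    · exact h1 h.symm
    · exact h2 u hu hu1 hu2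
  · rintro (h | ⟨u, hu, hu1, hu2⟩)
    · rw [hτ.1] at h
      exact h1 h
    · rw [hτ.1] at hu2
      refine h2 (τ u) (fun h => hu ?_) hu2 (by rw [hτ.1]; exact hu1)
      rw [← h, hτ.1]

/-- A bad half-edge of a pairing can be repaired by a switching. -/
theorem exists_switch {σ : Equiv.Perm (V × K)} (hσ : IsPairing σ) {x : V × K}
    (hx : IsBadHalfEdge σ x)
    (hcard : (badHalfEdges σ).card + 2 * ((2 + 2 * Fintype.card K) * Fintype.card K) <
      Fintype.card (V × K)) :
    ∃ y z, badHalfEdges (Equiv.swap y z * σ * (Equiv.swap y z)⁻¹) ⊂ badHalfEdges σ := by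
  set y := σ x with hy
  have hyx : y ≠ x := hσ.2 x
  have hσy : σ y = x := hσ.1 x
  -- The vertices of `x` and `y` and all their neighbors. A pair {z, w} with both ends outside `N`
  -- can be exchanged with {x, y} without creating a multiple edge.
  set N : Finset V := {x.1, y.1} ∪ (Finset.univ.image fun k => (σ (x.1, k)).1) ∪
    (Finset.univ.image fun k => (σ (y.1, k)).1) with hN
  have hNcard : N.card ≤ 2 + 2 * Fintype.card K := by
    refine (Finset.card_union_le _ _).trans ?_
    have h1 := Finset.card_union_le ({x.1, y.1} : Finset V)
      (Finset.univ.image fun k => (σ (x.1, k)).1)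
    have h2 := Finset.card_le_two (a := x.1) (b := y.1)
    have h3 := Finset.card_image_le (s := Finset.univ) (f := fun k => (σ (x.1, k)).1)
    have h4 := Finset.card_image_le (s := Finset.univ) (f := fun k => (σ (y.1, k)).1)
    simp only [Finset.card_univ] at h3 h4
    omega
  obtain ⟨z, hz⟩ : ∃ z, z ∉ (N ×ˢ (Finset.univ : Finset K)) ∪
      (N ×ˢ (Finset.univ : Finset K)).image σ ∪ badHalfEdges σ := by
    by_contra! hall
    have h1 : Fintype.card (V × K) ≤ _ := Finset.card_le_card (fun z _ => hall z)
    have h2 := Finset.card_union_le ((N ×ˢ (Finset.univ : Finset K)) ∪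
      (N ×ˢ (Finset.univ : Finset K)).image σ) (badHalfEdges σ)
    have h3 := Finset.card_union_le (N ×ˢ (Finset.univ : Finset K))
      ((N ×ˢ (Finset.univ : Finset K)).image σ)
    have h4 := Finset.card_image_le (s := N ×ˢ (Finset.univ : Finset K)) (f := σ)
    have h5 : (N ×ˢ (Finset.univ : Finset K)).card ≤
        (2 + 2 * Fintype.card K) * Fintype.card K := by
      rw [Finset.card_product, Finset.card_univ]
      exact Nat.mul_le_mul_right _ hNcard
    omega
  simp only [Finset.mem_union, not_or, mem_badHalfEdges] at hz
  obtain ⟨⟨hz1, hz2⟩, hz3⟩ := hz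
  set w := σ z with hw
  have hσw : σ w = z := hσ.1 z
  replace hz1 : z.1 ∉ N := fun h => hz1 (Finset.mem_product.2 ⟨h, Finset.mem_univ _⟩)
  have hw1 : w.1 ∉ N := fun h => hz2 (Finset.mem_image.2
    ⟨w, Finset.mem_product.2 ⟨h, Finset.mem_univ _⟩, hσw⟩)
  have hwz : w.1 ≠ z.1 := fun h => hz3 (Or.inl h)
  have hxN : x.1 ∈ N := by simp [hN]
  have hyN : y.1 ∈ N := by simp [hN]
  have hnx : ∀ u : V × K, u.1 = x.1 → (σ u).1 ∈ N := by
    intro u hu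
    simp only [hN, Finset.mem_union, Finset.mem_image, Finset.mem_univ, true_and]
    exact Or.inl (Or.inr ⟨u.2, by rw [← hu]⟩)
  have hny : ∀ u : V × K, u.1 = y.1 → (σ u).1 ∈ N := by
    intro u hu
    simp only [hN, Finset.mem_union, Finset.mem_image, Finset.mem_univ, true_and]
    exact Or.inr ⟨u.2, by rw [← hu]⟩
  have ne_of : ∀ {a b : V × K}, a.1 ∈ N → b.1 ∉ N → a ≠ b := by
    rintro a b ha hb rfl
    exact hb ha
  refine ⟨y, z, ?_⟩
  set τ := Equiv.swap y z * σ * (Equiv.swap y z)⁻¹ with hτdef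
  have hτ : IsPairing τ := hσ.conj _
  have hτx : τ x = z := by
    simp [hτdef, Equiv.swap_apply_of_ne_of_ne hyx.symm (ne_of hxN hz1), ← hy]
  have hτy : τ y = w := by
    simp [hτdef, ← hw, Equiv.swap_apply_of_ne_of_ne (ne_of hyN hw1).symm (hσ.2 z)]
  have hτz : τ z = x := by rw [← hτx, hτ.1]
  have hτw : τ w = y := by rw [← hτy, hτ.1]
  have hτu : ∀ u, u ≠ x → u ≠ y → u ≠ z → u ≠ w → τ u = σ u := by
    intro u h1 h2 h3 h4
    have h5 : σ u ≠ y := fun h => h1 (σ.injective h)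
    have h6 : σ u ≠ z := fun h => h4 (by rw [← hσ.1 u, h])
    simp [hτdef, Equiv.swap_apply_of_ne_of_ne h2 h3, Equiv.swap_apply_of_ne_of_ne h5 h6]
  have gxz := not_isBadHalfEdge_of_forall hτ hτx (fun h => hz1 (h ▸ hxN)) (by
    intro u hu hux
    by_cases huy : u = y
    · rw [huy, hτy]
      exact hwz
    · rw [hτu u hu huy (ne_of (hux ▸ hxN) hz1) (ne_of (hux ▸ hxN) hw1)]
      exact fun h => hz1 (h ▸ hnx u hux))
  have gyw := not_isBadHalfEdge_of_forall hτ hτy (fun h => hw1 (h ▸ hyN)) (by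
    intro u hu huy
    by_cases hux : u = x
    · rw [hux, hτx]
      exact hwz.symm
    · rw [hτu u hux hu (ne_of (huy ▸ hyN) hz1) (ne_of (huy ▸ hyN) hw1)]
      exact fun h => hw1 (h ▸ hny u huy))
  -- The four rewired half-edges are good after the switching, so a bad half-edge, and likewise its
  -- witness, keeps its old partner and was bad before.
  have same : ∀ u, IsBadHalfEdge τ u → τ u = σ u := by
    intro u hu
    refine hτu u ?_ ?_ ?_ ?_ <;> rintro rfl
    · exact gxz.1 hu
    · exact gyw.1 hu
    · exact gxz.2 hu
    · exact gyw.2 hu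
  rw [Finset.ssubset_iff_of_subset]
  · exact ⟨x, mem_badHalfEdges.2 hx, fun h => gxz.1 (mem_badHalfEdges.1 h)⟩
  · intro u hu
    rw [mem_badHalfEdges] at hu ⊢
    have hsu := same u hu
    rcases hu with h | ⟨v, h1, h2, h3⟩
    · exact Or.inl (by rwa [← hsu])
    · have hv : IsBadHalfEdge τ v := Or.inr ⟨u, h1.symm, h2.symm, h3.symm⟩
      exact Or.inr ⟨v, h1, h2, by rwa [← hsu, ← same v hv]⟩

variable (V K) in
/-- The pairings without loops and multiple edges. -/
def simplePairings : Finset (Equiv.Perm (V × K)) :=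
  (pairings (V × K)).filter fun σ => (badHalfEdges σ).card ≤ 0

theorem mem_simplePairings {σ : Equiv.Perm (V × K)} :
    σ ∈ simplePairings V K ↔ IsPairing σ ∧ ∀ x, ¬ IsBadHalfEdge σ x := by
  simp [simplePairings, mem_pairings, Finset.eq_empty_iff_forall_notMem, mem_badHalfEdges]

variable (V K) in
theorem card_filter_badHalfEdges_le (k : ℕ)
    (hk : k + 2 * ((2 + 2 * Fintype.card K) * Fintype.card K) < Fintype.card (V × K)) :
    ((pairings (V × K)).filter fun σ => (badHalfEdges σ).card ≤ k).card ≤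
      (simplePairings V K).card * (Fintype.card (V × K) ^ 2) ^ k := by
  induction k with
  | zero => simp [simplePairings]
  | succ k ih =>
    rw [pow_succ, ← mul_assoc]
    refine le_trans ?_ (Nat.mul_le_mul_right _ (ih (by omega)))
    calc _ ≤ (((pairings (V × K)).filter fun σ => (badHalfEdges σ).card ≤ k) ×ˢ
          (Finset.univ : Finset ((V × K) × (V × K)))).card := by
          -- A switching is undone by the same transposition, so `σ` is recovered from the switched
          -- pairing and the pair (y, z). Each removed level of badness thus costs a factor |V ×
          -- K|².
          refine Finset.card_le_card_of_surjOn (fun p =>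
            Equiv.swap p.2.1 p.2.2 * p.1 * (Equiv.swap p.2.1 p.2.2)⁻¹) ?_
          intro σ hσ
          simp only [Finset.coe_filter, Set.mem_ofPred_eq] at hσ
          obtain ⟨hσ, hb⟩ := hσ
          by_cases h0 : ∃ x, IsBadHalfEdge σ x
          · obtain ⟨x, hx⟩ := h0
            obtain ⟨y, z, hyz⟩ := exists_switch (mem_pairings.1 hσ) hx (by omega)
            refine ⟨(Equiv.swap y z * σ * (Equiv.swap y z)⁻¹, (y, z)), ?_, ?_⟩
            · have := Finset.card_lt_card hyz
              simp only [Finset.coe_product, Set.mem_prod, Finset.mem_coe, Finset.mem_filter,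
                Finset.mem_univ, and_true]
              exact ⟨mem_pairings.2 ((mem_pairings.1 hσ).conj _), by omega⟩
            · ext1 u
              simp
          · have hemp : badHalfEdges σ = ∅ := Finset.eq_empty_of_forall_notMem
              fun x hx => h0 ⟨x, mem_badHalfEdges.1 hx⟩
            have hne : Nonempty (V × K) := Fintype.card_pos_iff.1 (by omega)
            obtain ⟨x⟩ := hne
            -- A pairing that is already simple is recovered from itself with the trivial swap.
            exact ⟨(σ, (x, x)), by simp [hσ, hemp], by ext1 u; simp⟩
      _ = _ := by
        rw [Finset.card_product, Finset.card_univ, Fintype.card_prod, sq]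

variable (V K) in
/-- At least a polynomial proportion of all pairings is simple. -/
theorem card_pairings_le_simplePairings (hK : 0 < Fintype.card K)
    (hcard : 16 * Fintype.card K ^ 2 < Fintype.card (V × K)) :
    (pairings (V × K)).card ≤ 2 * ((simplePairings V K).card *
      (Fintype.card (V × K) ^ 2) ^ (8 * Fintype.card K ^ 2)) := by
  have hsq : Fintype.card K ≤ Fintype.card K ^ 2 := Nat.le_self_pow (by norm_num) _
  refine (card_pairings_le_two_mul V K hK (by omega)).trans (Nat.mul_le_mul_left _ ?_)
  refine card_filter_badHalfEdges_le V K _ ?_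
  nlinarith

end badHalfEdges

/-! ### Pairings of half-edges and regular graphs -/

section realization

variable {V K : Type*}

/-- The graph `G` arises from the pairing `σ` of half-edges. -/
structure IsRealization (G : SimpleGraph V) (σ : Equiv.Perm (V × K)) : Prop where
  isPairing : IsPairing σ
  injective : ∀ v, Function.Injective fun k => (σ (v, k)).1
  range : ∀ v, (Set.range fun k => (σ (v, k)).1) = G.neighborSet v

namespace IsRealization

theorem unique {G H : SimpleGraph V} {σ : Equiv.Perm (V × K)} (hG : IsRealization G σ)
    (hH : IsRealization H σ) : G = H := by
  ext u v
  rw [← SimpleGraph.mem_neighborSet, ← SimpleGraph.mem_neighborSet, ← hG.range, ← hH.range]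

/-- The enumeration of the neighbors of a vertex by the half-edges. -/
def enum {G : SimpleGraph V} {σ : Equiv.Perm (V × K)} (h : IsRealization G σ) (v : V) :
    K ≃ G.neighborSet v :=
  Equiv.ofBijective (fun k => ⟨(σ (v, k)).1, h.range v ▸ Set.mem_range_self k⟩)
    ⟨fun k l hkl => h.injective v (congrArg Subtype.val hkl), fun ⟨w, hw⟩ => by
      rw [← h.range] at hw
      obtain ⟨k, hk⟩ := hw
      exact ⟨k, Subtype.ext hk⟩⟩

end IsRealization

/-- The other end of a half-edge, for given enumerations of the neighborhoods. -/
def halfEdgeFlip (G : SimpleGraph V) (L : ∀ v, K ≃ G.neighborSet v) (x : V × K) : V × K :=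
  ((L x.1 x.2).1, (L (L x.1 x.2).1).symm ⟨x.1, (L x.1 x.2).2.symm⟩)

theorem halfEdgeFlip_eq_iff (G : SimpleGraph V) (L : ∀ v, K ≃ G.neighborSet v) (x y : V × K) :
    halfEdgeFlip G L x = y ↔ (L x.1 x.2).1 = y.1 ∧ (L y.1 y.2).1 = x.1 := by
  obtain ⟨v, k⟩ := x
  obtain ⟨w, l⟩ := y
  simp only [halfEdgeFlip, Prod.mk.injEq]
  refine and_congr_right ?_
  rintro rfl
  rw [Equiv.symm_apply_eq, Subtype.ext_iff]
  exact eq_comm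

theorem halfEdgeFlip_involutive (G : SimpleGraph V) (L : ∀ v, K ≃ G.neighborSet v) :
    Function.Involutive (halfEdgeFlip G L) := by
  intro x
  rw [halfEdgeFlip_eq_iff]
  exact ((halfEdgeFlip_eq_iff G L x _).1 rfl).symm

theorem isRealization_halfEdgeFlip (G : SimpleGraph V) (L : ∀ v, K ≃ G.neighborSet v) :
    IsRealization G (halfEdgeFlip_involutive G L).toPerm where
  isPairing := by
    refine ⟨halfEdgeFlip_involutive G L, fun x hx => ?_⟩
    have h := (L x.1 x.2).2
    rw [((halfEdgeFlip_eq_iff G L x x).1 hx).1] at h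
    exact G.loopless.irrefl _ h
  injective v k l h := (L v).injective (Subtype.ext h)
  range v := by
    ext w
    constructor
    · rintro ⟨k, rfl⟩
      exact (L v k).2
    · intro hw
      exact ⟨(L v).symm ⟨w, hw⟩, by simp [halfEdgeFlip]⟩

/-- The pairings that realize `G` correspond to the enumerations of the neighborhoods in `G`. -/
def realizationEquiv (G : SimpleGraph V) :
    {σ : Equiv.Perm (V × K) // IsRealization G σ} ≃ ∀ v, K ≃ G.neighborSet v where
  toFun σ := σ.2.enum
  invFun L := ⟨_, isRealization_halfEdgeFlip G L⟩
  left_inv := by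
    rintro ⟨σ, hσ⟩
    apply Subtype.ext
    ext1 x
    change halfEdgeFlip G hσ.enum x = σ x
    rw [halfEdgeFlip_eq_iff]
    refine ⟨rfl, ?_⟩
    change (σ (σ x)).1 = x.1
    rw [hσ.isPairing.1]
  right_inv L := by
    funext v
    ext k
    rfl

end realization

/-! ### Transfer of counts from pairings to regular graphs -/

section count

variable {n d : ℕ}

/-- The neighborhoods are enumerated independently of each other. The count is the same for all `G`,
so a uniform simple pairing induces a uniform regular graph. -/
theorem card_realization (G : RegularGraphOn d n) :
    Nat.card {σ : Equiv.Perm (Fin n × Fin d) // IsRealization G.1 σ} = d.factorial ^ n := by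
  classical
  rw [Nat.card_congr (realizationEquiv G.1), Nat.card_eq_fintype_card, Fintype.card_pi]
  have : ∀ v, Fintype.card (Fin d ≃ G.1.neighborSet v) = d.factorial := by
    intro v
    have hc : Fintype.card (G.1.neighborSet v) = d := by
      rw [← Nat.card_eq_fintype_card, Nat.card_coe_set_eq, G.2 v]
    rw [Fintype.card_equiv ((Fintype.equivFinOfCardEq hc).symm), Fintype.card_fin]
  simp [this]

theorem IsRealization.mem_simplePairings {G : SimpleGraph (Fin n)}
    {σ : Equiv.Perm (Fin n × Fin d)} (h : IsRealization G σ) :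
    σ ∈ simplePairings (Fin n) (Fin d) := by
  rw [_root_.mem_simplePairings]
  refine ⟨h.isPairing, ?_⟩
  rintro ⟨v, k⟩ (hl | ⟨⟨u, l⟩, h1, rfl, h3⟩)
  · have : v ∈ G.neighborSet v := by
      rw [← h.range]
      exact ⟨k, hl⟩
    exact G.loopless.irrefl _ this
  · exact h1 (by rw [h.injective u h3])

theorem exists_isRealization {σ : Equiv.Perm (Fin n × Fin d)}
    (hσ : σ ∈ simplePairings (Fin n) (Fin d)) :
    ∃ G : RegularGraphOn d n, IsRealization G.1 σ := by
  rw [mem_simplePairings] at hσ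
  let G : SimpleGraph (Fin n) :=
    { Adj := fun u v => ∃ k, (σ (u, k)).1 = v
      symm := ⟨by
        rintro u v ⟨k, rfl⟩
        exact ⟨(σ (u, k)).2, by rw [Prod.mk.eta, hσ.1.1]⟩⟩
      loopless := ⟨fun v ⟨k, hk⟩ => hσ.2 (v, k) (Or.inl hk)⟩ }
  have hG : IsRealization G σ :=
    ⟨hσ.1, fun v k l hkl => by
      by_contra hne
      exact hσ.2 (v, k) (Or.inr ⟨(v, l), fun h => hne (Prod.ext_iff.1 h).2.symm, rfl, hkl.symm⟩),
      fun v => rfl⟩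
  refine ⟨⟨G, fun v => ?_⟩, hG⟩
  rw [← hG.range, Set.ncard_range_of_injective (hG.injective v), Nat.card_eq_fintype_card,
    Fintype.card_fin]

/-- If all realizations of the graphs in `E` belong to `U`, then the proportion of `E` among the
regular graphs is at most the ratio of the sizes of `U` and of the set of simple pairings. -/
theorem ncard_mul_card_simplePairings_le (E : Set (RegularGraphOn d n))
    (U : Finset (Equiv.Perm (Fin n × Fin d)))
    (hU : ∀ G ∈ E, ∀ σ : Equiv.Perm (Fin n × Fin d), IsRealization G.1 σ → σ ∈ U) :
    E.ncard * (simplePairings (Fin n) (Fin d)).card ≤ Nat.card (RegularGraphOn d n) * U.card := by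
  classical
  have : Fintype (RegularGraphOn d n) := Fintype.ofFinite _
  let R : RegularGraphOn d n → Finset (Equiv.Perm (Fin n × Fin d)) :=
    fun G => {σ | IsRealization G.1 σ}
  have hR : ∀ G, (R G).card = d.factorial ^ n := by
    intro G
    rw [← card_realization G, Nat.card_eq_fintype_card, Fintype.card_subtype]
  -- Distinct graphs have disjoint sets of realizations, all of equal size. The blocks over `E` lie
  -- in `U`, while the blocks over all graphs cover the simple pairings.
  have hdisj : ∀ A : Finset (RegularGraphOn d n),
      (A.biUnion R).card = A.card * d.factorial ^ n := by
    intro A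
    rw [Finset.card_biUnion, Finset.sum_const_nat fun G _ => hR G]
    intro G _ H _ hGH
    refine Finset.disjoint_left.2 fun σ h1 h2 => hGH ?_
    simp only [R, Finset.mem_filter, Finset.mem_univ, true_and] at h1 h2
    exact Subtype.ext (h1.unique h2)
  have h1 : (simplePairings (Fin n) (Fin d)).card ≤
      Nat.card (RegularGraphOn d n) * d.factorial ^ n := by
    rw [Nat.card_eq_fintype_card, ← Finset.card_univ, ← hdisj]
    refine Finset.card_le_card fun σ hσ => ?_
    obtain ⟨G, hG⟩ := exists_isRealization hσ
    simp only [Finset.mem_biUnion, Finset.mem_univ, true_and, R, Finset.mem_filter]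
    exact ⟨G, hG⟩
  have h2 : E.ncard * d.factorial ^ n ≤ U.card := by
    rw [Set.ncard_eq_toFinset_card', ← hdisj]
    refine Finset.card_le_card fun σ hσ => ?_
    simp only [Finset.mem_biUnion, R, Finset.mem_filter, Finset.mem_univ, true_and,
      Set.mem_toFinset] at hσ
    obtain ⟨G, hG, hσ⟩ := hσ
    exact hU G hG σ hσ
  calc _ ≤ E.ncard * (Nat.card (RegularGraphOn d n) * d.factorial ^ n) :=
        Nat.mul_le_mul_left _ h1
    _ = Nat.card (RegularGraphOn d n) * (E.ncard * d.factorial ^ n) := by ring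
    _ ≤ _ := Nat.mul_le_mul_left _ h2

end count

/-! ### Counting colored pairings -/

theorem Nat.factorial_le_mul_div_exp_pow (m : ℕ) :
    (m.factorial : ℝ) ≤ Real.exp 1 * (m + 1) * (m / Real.exp 1) ^ m := by
  have key : ∀ k : ℕ, ((k + 1).factorial : ℝ) ≤
      Real.exp 1 * (k + 1) * ((k + 1) / Real.exp 1) ^ (k + 1) := by
    intro k
    induction k with
    | zero => simp
    | succ k ih =>
      -- The induction step reduces to this; it is the (k+2)-nd power of 1 - 1/(k+2) ≤
      -- exp(-1/(k+2)).
      have h1 : Real.exp 1 * ((k : ℝ) + 1) ^ (k + 2) ≤ ((k : ℝ) + 2) ^ (k + 2) := by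
        have h2 := Real.add_one_le_exp (-(1 / ((k : ℝ) + 2)))
        have h3 : -(1 / ((k : ℝ) + 2)) + 1 = (k + 1) / (k + 2) := by field_simp; ring
        rw [h3] at h2
        have h4 := pow_le_pow_left₀ (by positivity) h2 (k + 2)
        rw [← Real.exp_nat_mul, div_pow] at h4
        have h5 : ((k + 2 : ℕ) : ℝ) * -(1 / ((k : ℝ) + 2)) = -1 := by push_cast; field_simp
        rw [h5, Real.exp_neg, div_le_iff₀ (by positivity)] at h4
        calc _ ≤ Real.exp 1 * ((Real.exp 1)⁻¹ * (k + 2) ^ (k + 2)) :=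
              mul_le_mul_of_nonneg_left h4 (Real.exp_nonneg _)
          _ = _ := by field_simp
      rw [Nat.factorial_succ]
      push_cast
      have h6 : (((k : ℝ) + 1 + 1)) * (Real.exp 1 * (k + 1) * ((k + 1) / Real.exp 1) ^ (k + 1)) =
          (k + 2) / Real.exp 1 ^ (k + 1) * (Real.exp 1 * ((k : ℝ) + 1) ^ (k + 2)) := by
        rw [div_pow]
        ring
      have h7 : Real.exp 1 * ((k : ℝ) + 1 + 1) * (((k : ℝ) + 1 + 1) / Real.exp 1) ^ (k + 1 + 1) =
          (k + 2) / Real.exp 1 ^ (k + 1) * ((k : ℝ) + 2) ^ (k + 2) := by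
        rw [div_pow]
        have := Real.exp_ne_zero 1
        field_simp
        ring
      calc _ ≤ ((k : ℝ) + 1 + 1) * (Real.exp 1 * (k + 1) * ((k + 1) / Real.exp 1) ^ (k + 1)) :=
            mul_le_mul_of_nonneg_left ih (by positivity)
        _ ≤ _ := by
          rw [h6, h7]
          exact mul_le_mul_of_nonneg_left h1 (by positivity)
  rcases m with _ | k
  · simp
  · refine (key k).trans ?_
    push_cast
    gcongr
    linarith

theorem div_exp_pow_le_factorial (m : ℕ) : ((m : ℝ) / Real.exp 1) ^ m ≤ m.factorial := by
  have h := Real.pow_div_factorial_le_exp (m : ℝ) (by positivity) m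
  rw [div_le_iff₀ (by positivity)] at h
  rw [div_pow, div_le_iff₀ (by positivity), ← Real.exp_nat_mul, mul_one, mul_comm]
  exact h

/-- The number of words of small information content. -/
theorem card_filter_sum_neg_log_le {V A : Type*} [Fintype V] [DecidableEq V] [Fintype A]
    (p : A → ℝ) (hp : ∀ a, 0 < p a) (hsum : ∑ a, p a ≤ 1) (c : ℝ) (T : Finset (V → A))
    (hT : ∀ τ ∈ T, ∑ v, -Real.log (p (τ v)) ≤ c) : (T.card : ℝ) ≤ Real.exp c := by
  have h1 : ∑ τ : V → A, ∏ v, p (τ v) ≤ 1 := by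
    rw [← Fintype.prod_sum]
    simpa using pow_le_one₀ (Finset.sum_nonneg fun a _ => (hp a).le) hsum
  -- Under the product weight every word of `T` has mass at least exp(-c), and the total mass is at
  -- most one.
  have h2 : ∀ τ ∈ T, Real.exp (-c) ≤ ∏ v, p (τ v) := by
    intro τ hτ
    have h3 : ∏ v, p (τ v) = Real.exp (∑ v, Real.log (p (τ v))) := by
      rw [Real.exp_sum]
      exact Finset.prod_congr rfl fun v _ => (Real.exp_log (hp _)).symm
    rw [h3, Real.exp_le_exp]
    have := hT τ hτ
    rw [Finset.sum_neg_distrib] at this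
    linarith
  have h3 : T.card * Real.exp (-c) ≤ 1 := by
    calc T.card * Real.exp (-c) = ∑ τ ∈ T, Real.exp (-c) := by simp
      _ ≤ ∑ τ ∈ T, ∏ v, p (τ v) := Finset.sum_le_sum h2
      _ ≤ ∑ τ : V → A, ∏ v, p (τ v) := Finset.sum_le_univ_sum_of_nonneg fun τ =>
        Finset.prod_nonneg fun v _ => (hp _).le
      _ ≤ 1 := h1
  rw [Real.exp_neg, ← div_eq_mul_inv, div_le_one (Real.exp_pos _)] at h3
  exact h3

/-! ### Empirical entropy and multinomial coefficients -/

section labels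

variable {X L : Type*} [Fintype X] [DecidableEq X] [Fintype L] [DecidableEq L]

/-- The number of points with a given label. -/
def labelCount (f : X → L) (c : L) : ℕ := (Finset.univ.filter fun x => f x = c).card

/-- The entropy of the label of a random point. -/
def labelEntropy (f : X → L) : ℝ :=
  ∑ c, Real.negMulLog ((labelCount f c : ℝ) / Fintype.card X)

omit [DecidableEq X] in
theorem sum_labelCount (f : X → L) : ∑ c, labelCount f c = Fintype.card X := by
  rw [← Finset.card_univ, Finset.card_eq_sum_card_fiberwise (f := f) (t := Finset.univ)
    (fun _ _ => Finset.mem_coe.2 (Finset.mem_univ _))]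
  rfl

omit [DecidableEq X] [Fintype L] in
theorem labelCount_pos (f : X → L) (x : X) : 0 < labelCount f (f x) :=
  Finset.card_pos.2 ⟨x, by simp⟩

omit [DecidableEq X] in
-- The log-likelihood of a labeling under its own empirical distribution, grouped by labels.
theorem sum_log_labelCount (f : X → L) :
    ∑ x, Real.log ((labelCount f (f x) : ℝ) / Fintype.card X) =
      -(Fintype.card X * labelEntropy f) := by
  rw [← Finset.sum_fiberwise_of_maps_to (t := Finset.univ) (g := f) (fun _ _ => Finset.mem_univ _),
    labelEntropy, Finset.mul_sum, ← Finset.sum_neg_distrib]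
  refine Finset.sum_congr rfl fun c _ => ?_
  rw [Finset.sum_congr rfl (g := fun _ => Real.log ((labelCount f c : ℝ) / Fintype.card X))
    (fun x hx => by rw [(Finset.mem_filter.1 hx).2]), Finset.sum_const, nsmul_eq_mul,
    Real.negMulLog]
  change (labelCount f c : ℝ) * _ = _
  rcases Nat.eq_zero_or_pos (Fintype.card X) with h | h
  · have : labelCount f c = 0 := Nat.le_zero.1 (h ▸ Finset.card_le_univ _)
    simp [this]
  · field_simp

omit [DecidableEq X] in
/-- The multinomial coefficient is at least the exponential of the entropy, up to a polynomial
factor. -/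
theorem prod_factorial_mul_exp_le (f : X → L) :
    (∏ c, ((labelCount f c).factorial : ℝ)) * Real.exp (Fintype.card X * labelEntropy f) ≤
      (Fintype.card X).factorial * (Real.exp 1 * (Fintype.card X + 1)) ^ Fintype.card L := by
  set M := Fintype.card X with hM
  have hle : ∀ c, labelCount f c ≤ M := fun c => Finset.card_le_univ _
  have h1 : ∀ c, ((labelCount f c).factorial : ℝ) ≤ (Real.exp 1 * (M + 1)) *
      (((labelCount f c : ℝ) / M) ^ labelCount f c * (M / Real.exp 1) ^ labelCount f c) := by
    intro c
    refine (Nat.factorial_le_mul_div_exp_pow _).trans ?_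
    rw [← mul_pow]
    rcases Nat.eq_zero_or_pos M with h | h
    · have : labelCount f c = 0 := Nat.le_zero.1 (h ▸ hle c)
      simp [this, h]
    · have h2 : (labelCount f c : ℝ) / M * (M / Real.exp 1) = labelCount f c / Real.exp 1 := by
        field_simp
      rw [h2]
      have : (labelCount f c : ℝ) ≤ M := by exact_mod_cast hle c
      gcongr
  have h2 : ∀ c, ((labelCount f c : ℝ) / M) ^ labelCount f c *
      Real.exp (M * Real.negMulLog ((labelCount f c : ℝ) / M)) = 1 := by
    intro c
    rcases Nat.eq_zero_or_pos (labelCount f c) with h | h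
    · simp [h]
    · have hM0 : 0 < M := h.trans_le (hle c)
      have hpos : 0 < (labelCount f c : ℝ) / M := by positivity
      conv_lhs => rw [← Real.exp_log hpos, ← Real.exp_nat_mul, ← Real.exp_add]
      rw [Real.exp_log hpos, Real.negMulLog, Real.exp_eq_one_iff]
      field_simp
      ring
  calc _ ≤ (∏ c, (Real.exp 1 * (M + 1)) *
      (((labelCount f c : ℝ) / M) ^ labelCount f c * (M / Real.exp 1) ^ labelCount f c)) *
        Real.exp (M * labelEntropy f) := by
        gcongr with c
        exact h1 c
    _ = (Real.exp 1 * (M + 1)) ^ Fintype.card L * (M / Real.exp 1) ^ M *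
        ∏ c, (((labelCount f c : ℝ) / M) ^ labelCount f c *
          Real.exp (M * Real.negMulLog ((labelCount f c : ℝ) / M))) := by
        rw [labelEntropy, Finset.mul_sum, Real.exp_sum]
        simp only [Finset.prod_mul_distrib, Finset.prod_const, Finset.card_univ, mul_pow]
        rw [Finset.prod_pow_eq_pow_sum, sum_labelCount, ← hM]
        ring
    _ = (M / Real.exp 1) ^ M * (Real.exp 1 * (M + 1)) ^ Fintype.card L := by
        simp only [h2, Finset.prod_const_one]
        ring
    _ ≤ _ := mul_le_mul_of_nonneg_right (div_exp_pow_le_factorial M) (by positivity)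

end labels

/-! ### Pairings compatible with a labeling of half-edges -/

section compatible

variable {X S : Type*} [Fintype X] [DecidableEq X] [Fintype S] [DecidableEq S]

/-- A labeling of half-edges by ordered pairs of colors is compatible with a pairing if the two
half-edges of each pair carry opposite labels. -/
def IsCompatible (σ : Equiv.Perm X) (f : X → S × S) : Prop := ∀ x, f (σ x) = (f x).swap

instance (σ : Equiv.Perm X) : DecidablePred (IsCompatible (S := S) σ) := fun f =>
  inferInstanceAs (Decidable (∀ x, f (σ x) = (f x).swap))

/-- The number of compatible labelings with given label counts. -/
theorem card_compatible_labelings_le {σ : Equiv.Perm X} (hσ : IsPairing σ) (f : X → S × S) :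
    ((Finset.univ.filter fun g : X → S × S =>
      IsCompatible σ g ∧ labelCount g = labelCount f).card : ℝ) ≤
      Real.exp (Fintype.card X / 2 * labelEntropy f) := by
  set A := Finset.univ.filter fun g : X → S × S => IsCompatible σ g ∧ labelCount g = labelCount f
    with hA
  rcases isEmpty_or_nonempty X with hX | hX
  · have : A.card ≤ 1 := Finset.card_le_one.2 fun _ _ _ _ => Subsingleton.elim _ _
    have h0 : Fintype.card X = 0 := Fintype.card_eq_zero
    simp only [h0, Nat.cast_zero, zero_div, zero_mul, Real.exp_zero]
    exact_mod_cast this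
  set M := Fintype.card X with hM
  have hM0 : (0 : ℝ) < M := by exact_mod_cast Fintype.card_pos
  let e := Fintype.equivFin X
  let R : Finset X := Finset.univ.filter fun x => e x < e (σ x)
  have hRc : ∀ x, x ∉ R ↔ σ x ∈ R := by
    intro x
    have hne : e (σ x) ≠ e x := fun h => hσ.2 x (e.injective h)
    simp only [R, Finset.mem_filter, Finset.mem_univ, true_and, hσ.1, not_lt]
    exact ⟨fun h => lt_of_le_of_ne h hne, fun h => h.le⟩
  let q : S × S → ℝ := fun c => (labelCount f c : ℝ) / M
  have hq : ∀ c, 0 ≤ q c := fun c => by positivity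
  have hqsum : ∑ c, q c = 1 := by
    simp only [q, ← Finset.sum_div]
    rw [← Nat.cast_sum, sum_labelCount, div_self hM0.ne']
  have hsum : ∀ g ∈ A, ∑ x ∈ R, Real.log (q (g x)) = -(M / 2 * labelEntropy f) := by
    intro g hg
    obtain ⟨hg1, hg2⟩ := (Finset.mem_filter.1 hg).2
    -- Compatibility makes the label counts symmetric, so `R` and its complement carry equal
    -- log-likelihood, which is half of the total.
    have hsw : ∀ c, labelCount f c.swap = labelCount f c := by
      intro c
      rw [← hg2]
      refine Finset.card_bij (fun x _ => σ x) ?_ (fun _ _ _ _ h => σ.injective h) ?_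
      · intro x hx
        simp only [Finset.mem_filter, Finset.mem_univ, true_and] at hx ⊢
        rw [hg1, hx, Prod.swap_swap]
      · intro x hx
        simp only [Finset.mem_filter, Finset.mem_univ, true_and] at hx ⊢
        exact ⟨σ x, by rw [hg1, hx], hσ.1 x⟩
    have h1 : ∑ x ∈ Rᶜ, Real.log (q (g x)) = ∑ x ∈ R, Real.log (q (g x)) := by
      refine Finset.sum_bij (fun x _ => σ x) ?_ (fun _ _ _ _ h => σ.injective h) ?_ ?_
      · intro x hx
        exact (hRc x).1 (Finset.mem_compl.1 hx)
      · intro x hx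
        exact ⟨σ x, Finset.mem_compl.2 ((hRc _).2 (by rwa [hσ.1])), hσ.1 x⟩
      · intro x _
        simp only [q]
        rw [hg1, hsw]
    have h2 := Finset.sum_add_sum_compl R fun x => Real.log (q (g x))
    have h3 := sum_log_labelCount g
    have h4 : labelEntropy g = labelEntropy f := by simp only [labelEntropy, hg2]
    rw [hg2, h4] at h3
    rw [h1] at h2
    have : ∑ x, Real.log (q (g x)) = -(M * labelEntropy f) := h3
    linarith
  have hprod : ∀ g ∈ A, ∏ x ∈ R, q (g x) = Real.exp (-(M / 2 * labelEntropy f)) := by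
    intro g hg
    rw [← hsum g hg, Real.exp_sum]
    refine Finset.prod_congr rfl fun x _ => (Real.exp_log ?_).symm
    have := labelCount_pos g x
    rw [((Finset.mem_filter.1 hg).2).2] at this
    simp only [q]
    positivity
  have hinj : Set.InjOn (fun (g : X → S × S) (x : R) => g x) A := by
    intro g hg g' hg' h
    have hg1 := ((Finset.mem_filter.1 hg).2).1
    have hg1' := ((Finset.mem_filter.1 hg').2).1
    funext x
    by_cases hx : x ∈ R
    · exact congrFun h ⟨x, hx⟩
    · have h2 : g (σ x) = g' (σ x) := congrFun h ⟨σ x, (hRc x).1 hx⟩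
      rw [hg1, hg1'] at h2
      exact Prod.swap_injective h2
  have hle : ∑ g ∈ A, ∏ x ∈ R, q (g x) ≤ 1 := by
    calc ∑ g ∈ A, ∏ x ∈ R, q (g x)
        = ∑ g ∈ A, ∏ x : R, q (g x) := Finset.sum_congr rfl fun g _ =>
          (Finset.prod_coe_sort R fun x => q (g x)).symm
      _ = ∑ h ∈ A.image (fun (g : X → S × S) (x : R) => g x), ∏ x : R, q (h x) := by
          rw [Finset.sum_image hinj]
      _ ≤ ∑ h : R → S × S, ∏ x : R, q (h x) :=
          Finset.sum_le_univ_sum_of_nonneg fun h => Finset.prod_nonneg fun x _ => hq _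
      _ = 1 := by
          rw [← Fintype.prod_sum]
          simp [hqsum]
  rw [Finset.sum_congr rfl hprod, Finset.sum_const, nsmul_eq_mul, Real.exp_neg,
    ← div_eq_mul_inv, div_le_one (Real.exp_pos _)] at hle
  exact hle

/-- The fiber is a coset of the stabilizer of `f` in the symmetric group. -/
theorem card_perm_comp_eq (f : X → S × S) (g₀ : Equiv.Perm X) :
    (Finset.univ.filter fun g : Equiv.Perm X => f ∘ g = f ∘ g₀).card =
      ∏ c, (labelCount f c).factorial := by
  have h := DomMulAct.stabilizer_card f
  rw [Fintype.card_subtype] at h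
  rw [show ∏ c, (labelCount f c).factorial = ∏ c, (Fintype.card {a // f a = c}).factorial from
    Finset.prod_congr rfl fun c _ => by rw [Fintype.card_subtype]; rfl, ← h]
  refine Finset.card_bij (fun g _ => g * g₀⁻¹) ?_ (fun _ _ _ _ h => mul_right_cancel h) ?_
  · intro g hg
    simp only [Finset.mem_filter, Finset.mem_univ, true_and] at hg ⊢
    funext x
    simpa using congrFun hg (g₀⁻¹ x)
  · intro g hg
    simp only [Finset.mem_filter, Finset.mem_univ, true_and] at hg ⊢
    exact ⟨g * g₀, by funext x; exact congrFun hg (g₀ x), by simp⟩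

/-- The number of pairings that are compatible with a given labeling. -/
theorem card_compatible_pairings_le (f : X → S × S) :
    (((pairings X).filter fun σ => IsCompatible σ f).card : ℝ) ≤
      (pairings X).card * (Real.exp 1 * (Fintype.card X + 1)) ^ Fintype.card (S × S) *
        Real.exp (-(Fintype.card X / 2 * labelEntropy f)) := by
  set M := Fintype.card X with hM
  set N := ((pairings X).filter fun σ => IsCompatible σ f).card with hN
  set H := labelEntropy f with hH
  -- Conjugation carries pairings compatible with `f` to pairings compatible with `f ∘ g`. Hence `N`
  -- is bounded by an average over all relabelings, and double counting reduces the claim to the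
  -- number of compatible labelings of one fixed pairing.
  have h1 : ∀ g : Equiv.Perm X,
      N ≤ ((pairings X).filter fun σ => IsCompatible σ (f ∘ g)).card := by
    intro g
    refine Finset.card_le_card_of_injOn (fun σ => g⁻¹ * σ * g⁻¹⁻¹) ?_ (fun σ _ τ _ h => by
      simpa using h)
    intro σ hσ
    simp only [Finset.coe_filter, Set.mem_ofPred_eq] at hσ ⊢
    refine ⟨mem_pairings.2 ((mem_pairings.1 hσ.1).conj _), fun x => ?_⟩
    simpa using hσ.2 (g x)
  have h2 : (M.factorial : ℝ) * N ≤ ∑ σ ∈ pairings X,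
      ((Finset.univ.filter fun g : Equiv.Perm X => IsCompatible σ (f ∘ g)).card : ℝ) := by
    have : M.factorial * N ≤ ∑ g : Equiv.Perm X,
        ((pairings X).filter fun σ => IsCompatible σ (f ∘ g)).card := by
      rw [hM, ← Fintype.card_perm, ← Finset.card_univ, ← smul_eq_mul]
      exact Finset.card_nsmul_le_sum _ _ _ fun g _ => h1 g
    simp only [Finset.card_filter] at this ⊢
    rw [Finset.sum_comm] at this
    exact_mod_cast this
  have h3 : ∀ σ ∈ pairings X,
      ((Finset.univ.filter fun g : Equiv.Perm X => IsCompatible σ (f ∘ g)).card : ℝ) ≤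
        (∏ c, ((labelCount f c).factorial : ℝ)) * Real.exp (M / 2 * H) := by
    intro σ hσ
    refine le_trans ?_ (mul_le_mul_of_nonneg_left
      (card_compatible_labelings_le (mem_pairings.1 hσ) f) (by positivity))
    have h4 := Finset.card_le_mul_card_image_of_maps_to
      (s := Finset.univ.filter fun g : Equiv.Perm X => IsCompatible σ (f ∘ g))
      (t := Finset.univ.filter fun g : X → S × S =>
        IsCompatible σ g ∧ labelCount g = labelCount f) (f := fun g : Equiv.Perm X => f ∘ g) (by
        intro g hg
        simp only [Finset.mem_filter, Finset.mem_univ, true_and] at hg ⊢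
        refine ⟨hg, ?_⟩
        funext c
        refine Finset.card_bij (fun x _ => g x) (fun x hx => by simpa using hx)
          (fun _ _ _ _ h => g.injective h) (fun x hx => ⟨g⁻¹ x, by simpa using hx, by simp⟩))
      (∏ c, (labelCount f c).factorial) (by
        intro h _
        by_cases hne : ∃ g₀ : Equiv.Perm X, f ∘ g₀ = h
        · obtain ⟨g₀, rfl⟩ := hne
          rw [← card_perm_comp_eq f g₀]
          refine Finset.card_le_card fun g hg => ?_
          simp only [Finset.mem_filter, Finset.mem_univ, true_and] at hg ⊢
          exact hg.2
        · rw [Finset.filter_false_of_mem fun g _ hg => hne ⟨g, hg⟩]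
          simp)
    exact_mod_cast h4
  have h5 : (M.factorial : ℝ) * N ≤ (pairings X).card *
      ((∏ c, ((labelCount f c).factorial : ℝ)) * Real.exp (M / 2 * H)) := by
    refine h2.trans ((Finset.sum_le_sum h3).trans ?_)
    simp
  have h6 := prod_factorial_mul_exp_le f
  rw [← hM, ← hH] at h6
  have h7 : (M.factorial : ℝ) * N ≤ M.factorial * ((pairings X).card *
      (Real.exp 1 * (M + 1)) ^ Fintype.card (S × S) * Real.exp (-(M / 2 * H))) := by
    -- Compatible labelings contribute exp(MH/2), while all labelings with these counts number about
    -- exp(MH); the quotient is exp(-MH/2).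
    have e1 : Real.exp (M / 2 * H) = Real.exp (M * H) * Real.exp (-(M / 2 * H)) := by
      rw [← Real.exp_add]
      congr 1
      ring
    rw [e1] at h5
    calc _ ≤ _ := h5
      _ = (pairings X).card * Real.exp (-(M / 2 * H)) *
        ((∏ c, ((labelCount f c).factorial : ℝ)) * Real.exp (M * H)) := by ring
      _ ≤ (pairings X).card * Real.exp (-(M / 2 * H)) *
        (M.factorial * (Real.exp 1 * (M + 1)) ^ Fintype.card (S × S)) :=
          mul_le_mul_of_nonneg_left h6 (by positivity)
      _ = _ := by ring
  exact le_of_mul_le_mul_left h7 (by positivity)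

end compatible

/-! ### First moment bound over star types -/

section starTypes

variable {V K S : Type*} [Fintype V] [DecidableEq V] [Fintype K] [DecidableEq K] [Fintype S]
  [DecidableEq S]

/-- The color of a vertex and the colors at the other ends of its half-edges. -/
def starType (σ : Equiv.Perm (V × K)) (f : V → S) (v : V) : S × (K → S) :=
  (f v, fun k => f (σ (v, k)).1)

/-- The labels of the half-edges that are determined by the types of the vertices. -/
def halfEdgeLabel (τ : V → S × (K → S)) (x : V × K) : S × S := ((τ x.1).1, (τ x.1).2 x.2)

open scoped Classical in
/-- The number of pairings that admit a coloring with vertex types of small information content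
and with half-edge labels of large entropy. -/
theorem card_exists_coloring_le (p : S × (K → S) → ℝ) (hp : ∀ t, 0 < p t) (hsum : ∑ t, p t ≤ 1)
    (c h : ℝ) :
    (((pairings (V × K)).filter fun σ => ∃ f : V → S,
      ∑ v, -Real.log (p (starType σ f v)) ≤ c ∧
        h ≤ labelEntropy (halfEdgeLabel (starType σ f))).card : ℝ) ≤
      (pairings (V × K)).card *
        (Real.exp 1 * (Fintype.card (V × K) + 1)) ^ Fintype.card (S × S) *
          Real.exp (c - Fintype.card (V × K) / 2 * h) := by
  -- The union bound runs over abstract words of star types, which do not depend on the pairing. A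
  -- word realized by a coloring forces the pairing to be compatible with its half-edge labels.
  set T : Finset (V → S × (K → S)) := Finset.univ.filter fun τ =>
    ∑ v, -Real.log (p (τ v)) ≤ c ∧ h ≤ labelEntropy (halfEdgeLabel τ) with hT
  have hTcard := card_filter_sum_neg_log_le p hp hsum c T
    fun τ hτ => (Finset.mem_filter.1 hτ).2.1
  have hsub : ((pairings (V × K)).filter fun σ => ∃ f : V → S,
      ∑ v, -Real.log (p (starType σ f v)) ≤ c ∧
        h ≤ labelEntropy (halfEdgeLabel (starType σ f))) ⊆
      T.biUnion fun τ => (pairings (V × K)).filter fun σ =>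
        IsCompatible σ (halfEdgeLabel τ) := by
    intro σ hσ
    obtain ⟨hσ, f, h1, h2⟩ := Finset.mem_filter.1 hσ
    refine Finset.mem_biUnion.2 ⟨starType σ f, Finset.mem_filter.2 ⟨Finset.mem_univ _, h1, h2⟩,
      Finset.mem_filter.2 ⟨hσ, fun x => ?_⟩⟩
    simp [halfEdgeLabel, starType, (mem_pairings.1 hσ).1]
  set P : ℝ := (pairings (V × K)).card *
        (Real.exp 1 * (Fintype.card (V × K) + 1)) ^ Fintype.card (S × S) with hP
  calc _ ≤ (((T.biUnion fun τ => (pairings (V × K)).filter fun σ =>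
        IsCompatible σ (halfEdgeLabel τ)).card : ℕ) : ℝ) := by
          exact_mod_cast Finset.card_le_card hsub
    _ ≤ ∑ τ ∈ T, (((pairings (V × K)).filter fun σ =>
        IsCompatible σ (halfEdgeLabel τ)).card : ℝ) := by
          exact_mod_cast Finset.card_biUnion_le
    _ ≤ ∑ τ ∈ T, P * Real.exp (-(Fintype.card (V × K) / 2 * h)) := by
        refine Finset.sum_le_sum fun τ hτ => ?_
        refine (card_compatible_pairings_le (halfEdgeLabel τ)).trans ?_
        have := (Finset.mem_filter.1 hτ).2.2
        gcongr
    _ = T.card * (P * Real.exp (-(Fintype.card (V × K) / 2 * h))) := by simp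
    _ ≤ Real.exp c * (P * Real.exp (-(Fintype.card (V × K) / 2 * h))) :=
        mul_le_mul_of_nonneg_right hTcard (by positivity)
    _ = _ := by
        rw [sub_eq_add_neg, Real.exp_add]
        ring

end starTypes

/-! ### Neighborhoods of radius one -/

section star

variable {S : Type*} {d : ℕ}

/-- The star with `d` leaves, rooted at its center, with the colors `t`. -/
def coloredStar (t : S × (Fin d → S)) : RootedColoredGraph S where
  V := Option (Fin d)
  graph :=
    { Adj := fun u v => (u = none ∧ v ≠ none) ∨ (u ≠ none ∧ v = none)
      symm := ⟨fun _ _ h => h.elim (fun h => Or.inr ⟨h.2, h.1⟩) fun h => Or.inl ⟨h.2, h.1⟩⟩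
      loopless := ⟨fun _ h => h.elim (fun h => h.2 h.1) fun h => h.1 h.2⟩ }
  root := none
  color := fun u => u.elim t.1 t.2

/-- Two colorings of the star that differ by a permutation of the leaves. -/
def StarEquiv (t t' : S × (Fin d → S)) : Prop :=
  t.1 = t'.1 ∧ ∃ π : Equiv.Perm (Fin d), t'.2 ∘ π = t.2

theorem StarEquiv.refl (t : S × (Fin d → S)) : StarEquiv t t := ⟨rfl, 1, rfl⟩

theorem StarEquiv.symm {t t' : S × (Fin d → S)} (h : StarEquiv t t') : StarEquiv t' t := by
  obtain ⟨h1, π, h2⟩ := h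
  refine ⟨h1.symm, π⁻¹, ?_⟩
  rw [← h2]
  funext i
  simp

theorem StarEquiv.trans {t t' t'' : S × (Fin d → S)} (h : StarEquiv t t')
    (h' : StarEquiv t' t'') : StarEquiv t t'' := by
  obtain ⟨h1, π, h2⟩ := h
  obtain ⟨h3, ρ, h4⟩ := h'
  refine ⟨h1.trans h3, ρ * π, ?_⟩
  rw [← h2, ← h4]
  rfl

theorem edist_le_natCast_one_iff {V : Type} (G : SimpleGraph V) (v w : V) :
    G.edist v w ≤ (1 : ℕ) ↔ v = w ∨ G.Adj v w := by
  rw [Nat.cast_one, ← SimpleGraph.edist_eq_one_iff_adj, le_iff_lt_or_eq, Order.lt_one_iff,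
    SimpleGraph.edist_eq_zero_iff]

/-- Only this direction is available in a general graph: if two neighbors of `v` are adjacent, the
ball of radius one is not a star. -/
theorem starEquiv_of_isIso {V : Type} {G : SimpleGraph V} {f : V → S} {v : V}
    (e : Fin d ≃ G.neighborSet v) {t : S × (Fin d → S)}
    (h : (neighborhood G f v 1).IsIso (coloredStar t)) :
    StarEquiv (f v, fun i => f (e i)) t := by
  obtain ⟨E, hroot, hcol⟩ := h
  let u : Fin d → (neighborhood G f v 1).V := fun i =>
    ⟨(e i).1, (edist_le_natCast_one_iff G v _).2 (Or.inr (e i).2)⟩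
  have hadj : ∀ i, (neighborhood G f v 1).graph.Adj (neighborhood G f v 1).root (u i) :=
    fun i => (e i).2
  have hj : ∀ i, ∃ j : Fin d, E (u i) = some j := by
    intro i
    have h1 := E.map_adj_iff.2 (hadj i)
    rw [hroot] at h1
    rcases h1 with h1 | h1
    · exact Option.ne_none_iff_exists'.1 h1.2
    · exact absurd rfl h1.1
  choose j hj using hj
  have hinj : Function.Injective j := by
    intro a b hab
    have : E (u a) = E (u b) := by rw [hj, hj, hab]
    have := congrArg Subtype.val (E.injective this)
    exact e.injective (Subtype.ext this)
  refine ⟨?_, Equiv.ofBijective j (Finite.injective_iff_bijective.1 hinj), ?_⟩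
  · have := hcol (neighborhood G f v 1).root
    rw [hroot] at this
    exact this.symm
  · funext i
    have := hcol (u i)
    rw [hj] at this
    exact this

theorem isIso_coloredStar_iff (x : TreeVertex d → S) (t : S × (Fin d → S)) :
    (neighborhood (regularTree d) x (treeRoot d) 1).IsIso (coloredStar t) ↔
      StarEquiv (starColors (treeRoot d) x) t := by
  constructor
  · intro h
    let e : Fin d ≃ (regularTree d).neighborSet (treeRoot d) :=
      Equiv.ofBijective (fun i => ⟨treeStep i (treeRoot d), (treeAdj_iff _ _).2 ⟨i, rfl⟩⟩)
        ⟨fun i j hij => treeStep_injective _ (congrArg Subtype.val hij), fun ⟨w, hw⟩ => by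
          obtain ⟨i, hi⟩ := (treeAdj_iff _ _).1 hw
          exact ⟨i, Subtype.ext hi⟩⟩
    exact starEquiv_of_isIso e h
  · rintro ⟨h1, π, h2⟩
    let N := neighborhood (regularTree d) x (treeRoot d) 1
    let g : Option (Fin d) → N.V := fun o => o.elim N.root fun j =>
      ⟨treeStep (π⁻¹ j) (treeRoot d), (edist_le_natCast_one_iff _ _ _).2
        (Or.inr ((treeAdj_iff _ _).2 ⟨_, rfl⟩))⟩
    have hlen : ∀ i, (treeStep i (treeRoot d)).1 = [i] := fun i => rfl
    have hne : ∀ i, treeStep i (treeRoot d) ≠ treeRoot d := by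
      intro i h
      have := congrArg Subtype.val h
      rw [hlen] at this
      simp [treeRoot] at this
    have hbij : Function.Bijective g := by
      constructor
      · rintro (_ | i) (_ | j) hij
        · rfl
        · exact absurd (congrArg Subtype.val hij).symm (hne _)
        · exact absurd (congrArg Subtype.val hij) (hne _)
        · have := treeStep_injective _ (congrArg Subtype.val hij)
          rw [π⁻¹.injective this]
      · rintro ⟨w, hw⟩
        rcases (edist_le_natCast_one_iff _ _ _).1 hw with h | h
        · exact ⟨none, Subtype.ext h⟩
        · obtain ⟨i, rfl⟩ := (treeAdj_iff _ _).1 h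
          refine ⟨some (π i), Subtype.ext ?_⟩
          change treeStep (π⁻¹ (π i)) (treeRoot d) = _
          simp
    let E : (coloredStar t).graph ≃g N.graph :=
      { toEquiv := Equiv.ofBijective g hbij
        map_rel_iff' := by
          have hroot : ∀ i, N.graph.Adj (g none) (g (some i)) := fun i =>
            (treeAdj_iff _ _).2 ⟨_, rfl⟩
          rintro (_ | i) (_ | j)
          · exact ⟨fun h => absurd h (N.graph.loopless.irrefl _), fun h =>
              absurd h ((coloredStar t).graph.loopless.irrefl _)⟩
          · exact ⟨fun _ => Or.inl ⟨rfl, by simp⟩, fun _ => hroot j⟩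
          · exact ⟨fun _ => Or.inr ⟨by simp, rfl⟩, fun _ => (hroot i).symm⟩
          · refine ⟨fun h => ?_, fun h => ?_⟩
            -- Adjacent words differ in length by one, so two neighbors of the root are never
            -- adjacent.
            · obtain ⟨a, h | h⟩ : (regularTree d).Adj (treeStep (π⁻¹ i) (treeRoot d))
                (treeStep (π⁻¹ j) (treeRoot d)) := h <;>
              · rw [hlen, hlen] at h
                exact absurd (congrArg List.length h) (by simp)
            · rcases h with h | h
              · exact absurd h.1 (by simp)
              · exact absurd h.2 (by simp) }
    refine ⟨E.symm, ?_, fun v => ?_⟩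
    · exact E.symm_apply_eq.2 rfl
    · obtain ⟨o, rfl⟩ := hbij.2 v
      have : E.symm (g o) = o := E.symm_apply_eq.2 rfl
      rw [this]
      rcases o with _ | j
      · exact h1.symm
      · have := congrFun h2 (π⁻¹ j)
        rw [Function.comp, show π (π⁻¹ j) = j by simp] at this
        exact this

end star

/-! ### Benjamini--Schramm limits and averages over star types -/

section averages

variable {S : Type*} [Fintype S] {d : ℕ}

open scoped Classical in
/-- The number of colorings of the star that are equivalent to `t`. -/
def starClassCard (t : S × (Fin d → S)) : ℕ := (Finset.univ.filter fun t' => StarEquiv t t').card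

open scoped Classical in
-- Dividing by the class size compensates for the fact that every isomorphism class of colored stars
-- is listed once for each ordering of its leaf colors.
theorem sum_starEquiv_div (φ : S × (Fin d → S) → ℝ)
    (hφ : ∀ t t', StarEquiv t t' → φ t = φ t') (t : S × (Fin d → S)) :
    ∑ t', (if StarEquiv t t' then φ t' / starClassCard t' else 0) = φ t := by
  have hk : ∀ t', StarEquiv t t' → starClassCard t' = starClassCard t := by
    intro t' h
    unfold starClassCard
    congr 1
    ext t''
    simp only [Finset.mem_filter, Finset.mem_univ, true_and]
    exact ⟨h.trans, h.symm.trans⟩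
  have hpos : 0 < starClassCard t := Finset.card_pos.2 ⟨t, by simp [StarEquiv.refl]⟩
  rw [← Finset.sum_filter, Finset.sum_congr rfl (g := fun _ => φ t / starClassCard t)]
  · rw [Finset.sum_const, nsmul_eq_mul]
    change (starClassCard t : ℝ) * _ = _
    field_simp
  · intro t' ht'
    have := (Finset.mem_filter.1 ht').2
    rw [hk t' this, hφ t t' this]

theorem vertexProb_eq_sum (n : ℕ) (P : Fin n → Prop) [DecidablePred P] :
    vertexProb n P = (∑ v, if P v then (1 : ℝ) else 0) / n := by
  rw [vertexProb, Finset.sum_boole, Set.ncard_eq_toFinset_card']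
  congr 3
  ext v
  simp

open scoped Classical in
-- Vertices whose ball of radius one is not a star are missing on the left, so nonnegativity of `φ`
-- yields only an inequality.
theorem sum_mul_vertexProb_le (n : ℕ) (G : SimpleGraph (Fin n)) (f : Fin n → S)
    (e : ∀ v, Fin d ≃ G.neighborSet v) (φ : S × (Fin d → S) → ℝ)
    (hφ : ∀ t t', StarEquiv t t' → φ t = φ t') (h0 : ∀ t, 0 ≤ φ t) :
    ∑ t, φ t / starClassCard t * vertexProb n (fun v =>
      (neighborhood G f v 1).IsIso (coloredStar t)) ≤
      (∑ v, φ (f v, fun k => f (e v k))) / n := by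
  simp only [vertexProb_eq_sum, mul_div_assoc', ← Finset.sum_div]
  gcongr
  simp only [Finset.mul_sum]
  rw [Finset.sum_comm]
  refine Finset.sum_le_sum fun v _ => ?_
  rw [← sum_starEquiv_div φ hφ (f v, fun k => f (e v k))]
  refine Finset.sum_le_sum fun t _ => ?_
  by_cases h : (neighborhood G f v 1).IsIso (coloredStar t)
  · rw [if_pos h, if_pos (starEquiv_of_isIso (e v) h), mul_one]
  · rw [if_neg h, mul_zero]
    split_ifs
    · exact div_nonneg (h0 t) (Nat.cast_nonneg _)
    · exact le_rfl

variable [MeasurableSpace S] [MeasurableSingletonClass S]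

theorem sum_starLaw_mul (μ : Measure (TreeVertex d → S)) [IsProbabilityMeasure μ]
    (A : Set (S × (Fin d → S))) [DecidablePred (· ∈ A)] :
    μ.real {x | starColors (treeRoot d) x ∈ A} = ∑ t, if t ∈ A then starLaw μ t else 0 := by
  classical
  rw [measureReal_eq_sum_preimage μ (starColors (treeRoot d))
    (fun t => measurableSet_starColors_preimage _ _)]
  refine Finset.sum_congr rfl fun t _ => ?_
  split_ifs with h
  · rw [starLaw]
    congr 1
    ext x
    simp only [Set.mem_inter_iff, Set.mem_ofPred_eq, Set.mem_preimage, Set.mem_singleton_iff,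
      and_iff_right_iff_imp]
    rintro rfl
    exact h
  · convert measureReal_empty
    ext x
    simp only [Set.mem_inter_iff, Set.mem_ofPred_eq, Set.mem_preimage, Set.mem_singleton_iff,
      Set.mem_empty_iff_false, iff_false, not_and]
    rintro h1 rfl
    exact h h1

theorem sum_starLaw (μ : Measure (TreeVertex d → S)) [IsProbabilityMeasure μ] :
    ∑ t, starLaw μ t = 1 := by
  have h := sum_starLaw_mul μ Set.univ
  simpa using h.symm

theorem tendsto_sum_mul_vertexProb {n : ℕ → ℕ} {G : ∀ i, SimpleGraph (Fin (n i))}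
    {f : ∀ i, Fin (n i) → S} {μ : Measure (TreeVertex d → S)} [IsProbabilityMeasure μ]
    (hBS : IsBSLimit d n G f μ) (φ : S × (Fin d → S) → ℝ)
    (hφ : ∀ t t', StarEquiv t t' → φ t = φ t') :
    Tendsto (fun i => ∑ t, φ t / starClassCard t * vertexProb (n i) (fun v =>
      (neighborhood (G i) (f i) v 1).IsIso (coloredStar t))) atTop
      (𝓝 (∑ t, starLaw μ t * φ t)) := by
  classical
  have hlim : ∑ t, starLaw μ t * φ t = ∑ t, φ t / starClassCard t *
      μ.real {x | (neighborhood (regularTree d) x (treeRoot d) 1).IsIso (coloredStar t)} := by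
    have h1 : ∀ t : S × (Fin d → S),
        μ.real {x | (neighborhood (regularTree d) x (treeRoot d) 1).IsIso (coloredStar t)} =
        ∑ t', if StarEquiv t' t then starLaw μ t' else 0 := by
      intro t
      simp only [isIso_coloredStar_iff]
      exact sum_starLaw_mul μ {t' | StarEquiv t' t}
    simp only [h1, Finset.mul_sum]
    rw [Finset.sum_comm]
    refine Finset.sum_congr rfl fun t _ => ?_
    conv_lhs => rw [← sum_starEquiv_div φ hφ t, Finset.mul_sum]
    refine Finset.sum_congr rfl fun t' _ => ?_
    split_ifs <;> ring
  rw [hlim]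
  exact tendsto_finsetSum _ fun t _ => (hBS 1 (coloredStar t)).const_mul _

/-- The averages of a symmetric function of the star types converge. -/
theorem tendsto_average {n : ℕ → ℕ} (hn : ∀ i, 0 < n i) {G : ∀ i, SimpleGraph (Fin (n i))}
    {f : ∀ i, Fin (n i) → S} {μ : Measure (TreeVertex d → S)} [IsProbabilityMeasure μ]
    (hBS : IsBSLimit d n G f μ) (e : ∀ i v, Fin d ≃ (G i).neighborSet v)
    (φ : S × (Fin d → S) → ℝ) (hφ : ∀ t t', StarEquiv t t' → φ t = φ t') :
    Tendsto (fun i => (∑ v, φ (f i v, fun k => f i (e i v k))) / n i) atTop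
      (𝓝 (∑ t, starLaw μ t * φ t)) := by
  obtain ⟨B, hB⟩ : ∃ B, ∀ t, |φ t| ≤ B := by
    refine ⟨∑ t, |φ t|, fun t => ?_⟩
    exact Finset.single_le_sum (f := fun t => |φ t|) (fun _ _ => abs_nonneg _)
      (Finset.mem_univ t)
  have hn' : ∀ i, (n i : ℝ) ≠ 0 := fun i => by exact_mod_cast (hn i).ne'
  -- Shifting by `B` makes both `φ + B` and `B - φ` nonnegative, and the one-sided bound applied to
  -- each sandwiches the average. The bounds meet because the star laws have total mass one in the
  -- limit, so the missed vertices are negligible.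
  have lo := (tendsto_sum_mul_vertexProb hBS (fun t => φ t + B)
    fun t t' h => by simp only [hφ t t' h]).sub_const B
  have hi := (tendsto_sum_mul_vertexProb hBS (fun t => B - φ t)
    fun t t' h => by simp only [hφ t t' h]).const_sub B
  simp only [mul_add, Finset.sum_add_distrib, ← Finset.sum_mul, sum_starLaw, one_mul,
    add_sub_cancel_right] at lo
  simp only [mul_sub, Finset.sum_sub_distrib, ← Finset.sum_mul, sum_starLaw, one_mul,
    sub_sub_cancel] at hi
  refine tendsto_of_tendsto_of_tendsto_of_le_of_le lo hi (fun i => ?_) (fun i => ?_)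
  · have := sum_mul_vertexProb_le (n i) (G i) (f i) (e i) (fun t => φ t + B)
      (fun t t' h => by simp only [hφ t t' h]) (fun t => by linarith [neg_abs_le (φ t), hB t])
    rw [Finset.sum_add_distrib, add_div] at this
    simp only [Finset.sum_const, Finset.card_univ, Fintype.card_fin, nsmul_eq_mul] at this
    rw [mul_div_assoc, mul_div_cancel₀ _ (hn' i)] at this
    simp only
    linarith
  · have := sum_mul_vertexProb_le (n i) (G i) (f i) (e i) (fun t => B - φ t)
      (fun t t' h => by simp only [hφ t t' h]) (fun t => by linarith [le_abs_self (φ t), hB t])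
    rw [Finset.sum_sub_distrib, sub_div] at this
    simp only [Finset.sum_const, Finset.card_univ, Fintype.card_fin, nsmul_eq_mul] at this
    rw [mul_div_assoc, mul_div_cancel₀ _ (hn' i)] at this
    simp only
    linarith

end averages

/-! ### Sizes of large girth sequences -/

theorem exists_isCycle_of_regular {d n : ℕ} (hd : 2 ≤ d) (hn : 0 < n) (G : RegularGraphOn d n) :
    ∃ v, ∃ p : G.1.Walk v v, p.IsCycle ∧ p.length ≤ n := by
  classical
  have : Nonempty (Fin n) := ⟨⟨0, hn⟩⟩
  have hcyc : ¬ G.1.IsAcyclic := by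
    intro hac
    -- An acyclic graph extends to a spanning tree of the complete graph, with n - 1 edges, whereas
    -- a d-regular graph with d ≥ 2 has at least n edges.
    obtain ⟨F, hGF, -, hF⟩ :=
      SimpleGraph.connected_top.exists_isTree_le_of_le_of_isAcyclic le_top hac
    have h1 := hF.card_edgeFinset
    have h2 : G.1.edgeFinset.card ≤ F.edgeFinset.card :=
      Finset.card_le_card (SimpleGraph.edgeFinset_subset_edgeFinset.2 hGF)
    have h3 := G.1.sum_degrees_eq_twice_card_edges
    have h4 : ∀ v, G.1.degree v = d := by
      intro v
      rw [← SimpleGraph.card_neighborSet_eq_degree, ← Nat.card_eq_fintype_card,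
        Nat.card_coe_set_eq, G.2 v]
    simp only [h4, Finset.sum_const, Finset.card_univ, Fintype.card_fin, smul_eq_mul] at h1 h3
    nlinarith
  simp only [SimpleGraph.IsAcyclic, not_forall, not_not] at hcyc
  obtain ⟨v, p, hp⟩ := hcyc
  refine ⟨v, p, hp, ?_⟩
  have := hp.support_nodup.length_le_card
  simpa using this

/-- A graph with n < K vertices has a cycle of length at most n, so a random vertex lies on a short
cycle with probability at least 1/n > 1/(K + 1). -/
theorem IsLargeGirth.tendsto_atTop {d : ℕ} (hd : 2 ≤ d) {n : ℕ → ℕ} (hn : ∀ i, 0 < n i)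
    (G : ∀ i, RegularGraphOn d (n i)) (hG : IsLargeGirth n fun i => (G i).1) :
    Tendsto n atTop atTop := by
  refine Filter.tendsto_atTop.2 fun K => ?_
  obtain ⟨N, hN⟩ := hG (1 / (K + 1)) (by positivity)
  refine eventually_atTop.2 ⟨N, fun i hi => ?_⟩
  by_contra! hlt
  have h := hN i hi
  obtain ⟨v, p, hp, hlen⟩ := exists_isCycle_of_regular hd (hn i) (G i)
  have h1 : 1 ≤ {v : Fin (n i) | ∃ p : (G i).1.Walk v v, p.IsCycle ∧
      p.length ≤ ⌈1 / (1 / ((K : ℝ) + 1))⌉₊}.ncard := by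
    refine (Set.ncard_pos (Set.toFinite _)).2 ⟨v, p, hp, ?_⟩
    rw [one_div_one_div]
    refine hlen.trans (hlt.le.trans ?_)
    have hceil : (K : ℝ) ≤ ⌈(K : ℝ) + 1⌉₊ := (Nat.le_ceil ((K : ℝ) + 1)).trans' (by linarith)
    exact Nat.cast_le.1 hceil
  have hpos : (0 : ℝ) < n i := by exact_mod_cast hn i
  have hK : (n i : ℝ) < K := by exact_mod_cast hlt
  rw [vertexProb, div_le_div_iff₀ hpos (by positivity)] at h
  have h2 : (1 : ℝ) ≤ ({v : Fin (n i) | ∃ p : (G i).1.Walk v v, p.IsCycle ∧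
      p.length ≤ ⌈1 / (1 / ((K : ℝ) + 1))⌉₊}.ncard : ℝ) := by exact_mod_cast h1
  nlinarith

/-! ### Good colorings of random regular graphs -/

section good

variable {S : Type*} [Fintype S] [DecidableEq S] {d : ℕ}

/-- The coloring `f` of the graph given by the pairing `σ` has small average information content
and large entropy of the half-edge labels. -/
def IsGoodColoring {n : ℕ} (p : S × (Fin d → S) → ℝ) (c h : ℝ) (σ : Equiv.Perm (Fin n × Fin d))
    (f : Fin n → S) : Prop :=
  ∑ v, -Real.log (p (starType σ f v)) ≤ n * c ∧ h ≤ labelEntropy (halfEdgeLabel (starType σ f))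

/-- The regular graphs all whose realizations admit a good coloring. -/
def goodGraphs (n : ℕ) (p : S × (Fin d → S) → ℝ) (c h : ℝ) : Set (RegularGraphOn d n) :=
  {G | ∃ f, ∀ σ : Equiv.Perm (Fin n × Fin d), IsRealization G.1 σ → IsGoodColoring p c h σ f}

theorem exists_realization {n : ℕ} (G : RegularGraphOn d n) :
    ∃ σ : Equiv.Perm (Fin n × Fin d), IsRealization G.1 σ := by
  have h : 0 < Nat.card {σ : Equiv.Perm (Fin n × Fin d) // IsRealization G.1 σ} := by
    rw [card_realization]
    positivity
  obtain ⟨σ⟩ := (Nat.card_pos_iff.1 h).1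
  exact ⟨σ.1, σ.2⟩

omit [Fintype S] in
-- Writes a label frequency as the average of a symmetric function of the star type, the form that
-- `tendsto_average` handles.
theorem labelCount_halfEdgeLabel_div {n : ℕ} (τ : Fin n → S × (Fin d → S))
    (c : S × S) :
    (labelCount (halfEdgeLabel τ) c : ℝ) / Fintype.card (Fin n × Fin d) =
      (∑ v, (∑ k, if ((τ v).1, (τ v).2 k) = c then (1 : ℝ) else 0) / d) / n := by
  rw [labelCount, Finset.card_filter, Nat.cast_sum, Fintype.sum_prod_type, Fintype.card_prod,
    Fintype.card_fin, Fintype.card_fin, ← Finset.sum_div, div_div, Nat.cast_mul, mul_comm (d : ℝ)]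
  congr 1
  refine Finset.sum_congr rfl fun v _ => Finset.sum_congr rfl fun k _ => ?_
  by_cases h : ((τ v).1, (τ v).2 k) = c <;> simp [halfEdgeLabel, h]

variable [MeasurableSpace S] [MeasurableSingletonClass S]

/-- By invariance every leaf forms with the center a pair of the same law, so averaging over leaves
changes nothing. -/
theorem sum_starLaw_mul_edge {μ : Measure (TreeVertex d → S)} [IsProbabilityMeasure μ]
    (hμ : IsInvariantProcess d μ) (i : Fin d) (c : S × S) :
    ∑ t, starLaw μ t * ((∑ k, if (t.1, t.2 k) = c then (1 : ℝ) else 0) / d) = edgeLaw μ i c := by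
  have h1 : ∀ k : Fin d, ∑ t, starLaw μ t * (if (t.1, t.2 k) = c then (1 : ℝ) else 0) =
      edgeLaw μ i c := by
    intro k
    rw [← real_pair_preimage hμ i k (treeRoot d) c]
    refine Eq.trans ?_ (sum_starLaw_mul μ {t | (t.1, t.2 k) = c}).symm
    simp
  have hd : (d : ℝ) ≠ 0 := by
    have := i.pos
    positivity
  simp only [mul_div_assoc', ← Finset.sum_div, Finset.mul_sum]
  rw [Finset.sum_comm]
  simp only [h1]
  simp [hd]

/-- Along a sequence of regular graphs that has the process as a limit, the graphs are
eventually good. -/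
theorem eventually_mem_goodGraphs {n : ℕ → ℕ} (hn : ∀ i, 0 < n i)
    (G : ∀ i, RegularGraphOn d (n i)) {μ : Measure (TreeVertex d → S)} [IsProbabilityMeasure μ]
    (hμ : IsInvariantProcess d μ) {f : ∀ i, Fin (n i) → S}
    (hBS : IsBSLimit d n (fun i => (G i).1) f μ) (i₀ : Fin d) (p : S × (Fin d → S) → ℝ)
    (hp : ∀ t t', StarEquiv t t' → p t = p t') (c h : ℝ)
    (hc : ∑ t, starLaw μ t * -Real.log (p t) < c)
    (hh : h < ∑ q, Real.negMulLog (edgeLaw μ i₀ q)) :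
    ∀ᶠ i in atTop, G i ∈ goodGraphs (n i) p c h := by
  -- A worst realization is selected for each `i`: if any realization makes `f i` bad, `σ i` is such
  -- a one. Goodness along this single sequence then implies goodness for all realizations.
  have hchoice : ∀ i, ∃ σ : Equiv.Perm (Fin (n i) × Fin d), IsRealization (G i).1 σ ∧
      (IsGoodColoring p c h σ (f i) → G i ∈ goodGraphs (n i) p c h) := by
    intro i
    by_cases hall : ∀ σ : Equiv.Perm (Fin (n i) × Fin d), IsRealization (G i).1 σ →
        IsGoodColoring p c h σ (f i)
    · obtain ⟨σ, hσ⟩ := exists_realization (G i)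
      exact ⟨σ, hσ, fun _ => ⟨f i, hall⟩⟩
    · push Not at hall
      obtain ⟨σ, hσ, hbad⟩ := hall
      exact ⟨σ, hσ, fun hgood => absurd hgood hbad⟩
  choose σ hσ hgood using hchoice
  have avg := fun φ hφ => tendsto_average hn hBS (fun i v => (hσ i).enum v) φ hφ
  have h1 := avg (fun t => -Real.log (p t)) (fun t t' htt => by simp only [hp t t' htt])
  have h2 : Tendsto (fun i => labelEntropy (halfEdgeLabel (starType (σ i) (f i)))) atTop
      (𝓝 (∑ q, Real.negMulLog (edgeLaw μ i₀ q))) := by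
    unfold labelEntropy
    refine tendsto_finsetSum _ fun q _ => (Real.continuous_negMulLog.tendsto _).comp ?_
    have h3 := avg (fun t => (∑ k, if (t.1, t.2 k) = q then (1 : ℝ) else 0) / d) (by
      rintro ⟨a, s⟩ ⟨a', s'⟩ ⟨h1, π, h2⟩
      simp only at h1 h2
      subst h1 h2
      congr 1
      exact Equiv.sum_comp π fun k => if (a, s' k) = q then (1 : ℝ) else 0)
    rw [sum_starLaw_mul_edge hμ i₀ q] at h3
    refine h3.congr fun i => ?_
    rw [labelCount_halfEdgeLabel_div]
    rfl
  filter_upwards [h1.eventually_lt_const hc, h2.eventually_const_lt hh] with i hi1 hi2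
  refine hgood i ⟨?_, hi2.le⟩
  have hpos : (0 : ℝ) < n i := by exact_mod_cast hn i
  rw [div_lt_iff₀ hpos] at hi1
  rw [mul_comm]
  exact hi1.le

omit [MeasurableSpace S] [MeasurableSingletonClass S] in
/-- The proportion of good graphs among the regular graphs. -/
theorem ncard_goodGraphs_le {n : ℕ} (hd : 0 < d) (hn : 16 * d < n) (p : S × (Fin d → S) → ℝ)
    (hp : ∀ t, 0 < p t) (hsum : ∑ t, p t ≤ 1) (c h : ℝ) (hne : Nonempty (RegularGraphOn d n)) :
    ((goodGraphs n p c h).ncard : ℝ) ≤ Nat.card (RegularGraphOn d n) *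
      (2 * ((n * d : ℝ) ^ 2) ^ (8 * d ^ 2) *
        (Real.exp 1 * (n * d + 1)) ^ Fintype.card (S × S) * Real.exp (-(n * (d / 2 * h - c)))) := by
  classical
  have h1 := ncard_mul_card_simplePairings_le (goodGraphs n p c h)
    ((pairings (Fin n × Fin d)).filter fun σ => ∃ f : Fin n → S,
      ∑ v, -Real.log (p (starType σ f v)) ≤ n * c ∧
        h ≤ labelEntropy (halfEdgeLabel (starType σ f)))
    (fun G hG σ hσ => by
      obtain ⟨f, hf⟩ := hG
      exact Finset.mem_filter.2 ⟨mem_pairings.2 hσ.isPairing, f, hf σ hσ⟩)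
  have h2 := card_exists_coloring_le (V := Fin n) (K := Fin d) p hp hsum (n * c) h
  have h3 := card_pairings_le_simplePairings (Fin n) (Fin d) (by simpa using hd) (by
    simp only [Fintype.card_prod, Fintype.card_fin]
    nlinarith)
  have hs : 0 < (simplePairings (Fin n) (Fin d)).card := by
    obtain ⟨G⟩ := hne
    obtain ⟨σ, hσ⟩ := exists_realization G
    exact Finset.card_pos.2 ⟨σ, hσ.mem_simplePairings⟩
  simp only [Fintype.card_prod (Fin n) (Fin d), Fintype.card_fin, Nat.cast_mul] at h2 h3
  set s := (simplePairings (Fin n) (Fin d)).card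
  set U := ((pairings (Fin n × Fin d)).filter fun σ => ∃ f : Fin n → S,
      ∑ v, -Real.log (p (starType σ f v)) ≤ n * c ∧
        h ≤ labelEntropy (halfEdgeLabel (starType σ f))).card with hU
  have h3' : ((pairings (Fin n × Fin d)).card : ℝ) ≤
      2 * (s * ((n * d : ℝ) ^ 2) ^ (8 * d ^ 2)) := by exact_mod_cast h3
  have h1' : ((goodGraphs n p c h).ncard : ℝ) * s ≤ Nat.card (RegularGraphOn d n) * (U : ℝ) := by
    exact_mod_cast h1
  have hs' : (0 : ℝ) < s := by exact_mod_cast hs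
  refine le_of_mul_le_mul_right (h1'.trans ?_) hs'
  have e : (n * c - n * d / 2 * h : ℝ) = -(n * (d / 2 * h - c)) := by ring
  rw [e] at h2
  calc (Nat.card (RegularGraphOn d n) : ℝ) * U ≤ Nat.card (RegularGraphOn d n) *
      (2 * (s * ((n * d : ℝ) ^ 2) ^ (8 * d ^ 2)) *
        (Real.exp 1 * (n * d + 1)) ^ Fintype.card (S × S) *
        Real.exp (-(n * (d / 2 * h - c)))) := by
        refine mul_le_mul_of_nonneg_left (h2.trans ?_) (Nat.cast_nonneg _)
        gcongr
    _ = _ := by ring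

end good

theorem tendsto_polynomial_mul_exp_neg (d a b : ℕ) (κ : ℝ) (hκ : 0 < κ) :
    Tendsto (fun n : ℕ => 2 * ((n * d : ℝ) ^ 2) ^ a *
        (Real.exp 1 * (n * d + 1)) ^ b * Real.exp (-(n * κ))) atTop (𝓝 0) := by
  have h1 := (Real.tendsto_pow_mul_exp_neg_atTop_nhds_zero (2 * a + b)).comp
    (tendsto_natCast_atTop_atTop.atTop_mul_const hκ : Tendsto (fun n : ℕ => (n : ℝ) * κ) _ _)
  have h2 := h1.const_mul (2 * (d ^ 2) ^ a * (Real.exp 1 * (d + 1)) ^ b * (κ⁻¹) ^ (2 * a + b))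
  rw [mul_zero] at h2
  refine squeeze_zero' (Eventually.of_forall fun n => by positivity) ?_ h2
  filter_upwards [eventually_ge_atTop 1] with n hn
  have hn : (1 : ℝ) ≤ n := by exact_mod_cast hn
  have h3 : (Real.exp 1 * (n * d + 1)) ^ b ≤ (Real.exp 1 * (d + 1)) ^ b * (n : ℝ) ^ b := by
    rw [← mul_pow]
    refine pow_le_pow_left₀ (by positivity) ?_ b
    rw [mul_assoc]
    refine mul_le_mul_of_nonneg_left ?_ (Real.exp_nonneg _)
    nlinarith
  have h4 : (κ⁻¹) ^ (2 * a + b) * (n * κ) ^ (2 * a + b) = (n : ℝ) ^ (2 * a + b) := by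
    rw [← mul_pow]
    congr 1
    field_simp
  simp only [Function.comp]
  calc _ ≤ 2 * ((n * d : ℝ) ^ 2) ^ a * ((Real.exp 1 * (d + 1)) ^ b * (n : ℝ) ^ b) *
        Real.exp (-(n * κ)) := by gcongr
    _ = 2 * (d ^ 2) ^ a * (Real.exp 1 * (d + 1)) ^ b * (n : ℝ) ^ (2 * a + b) *
        Real.exp (-(n * κ)) := by ring
    _ = _ := by
      rw [← h4]
      ring

theorem uniformRegularGraph_le_half {d n : ℕ} (E : Set (RegularGraphOn d n))
    (hE : (E.ncard : ℝ) ≤ Nat.card (RegularGraphOn d n) * (1 / 2))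
    (hne : Nonempty (RegularGraphOn d n)) : uniformRegularGraph d n E ≤ 1 / 2 := by
  have : Fintype (RegularGraphOn d n) := Fintype.ofFinite _
  rw [Nat.card_eq_fintype_card] at hE
  rw [uniformRegularGraph, ProbabilityTheory.uniformOn_univ,
    Measure.count_apply_finite' (Set.toFinite E) trivial, ← Set.ncard_eq_toFinset_card E]
  have h1 : 2 * E.ncard ≤ Fintype.card (RegularGraphOn d n) := by
    have : (2 * E.ncard : ℝ) ≤ Fintype.card (RegularGraphOn d n) := by linarith
    exact_mod_cast this
  rw [ENNReal.div_le_iff (by simp) (by simp), one_div, mul_comm, ← div_eq_mul_inv,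
    ENNReal.le_div_iff_mul_le (by simp) (by simp), mul_comm]
  exact_mod_cast h1

/-! ### The star-edge entropy inequality -/

section starEdge

variable {S : Type*} [Fintype S] [MeasurableSpace S] [MeasurableSingletonClass S] {d : ℕ}

omit [Fintype S] [MeasurableSingletonClass S] in
theorem IsTypical.exists_memProfile {μ : Measure (TreeVertex d → S)} (hμ : IsTypical d μ) :
    ∃ n : ℕ → ℕ, (∀ i, 0 < n i) ∧ ∃ G : ∀ i, RegularGraphOn d (n i),
      MemProfile d n (fun i => (G i).1) μ := by
  obtain ⟨n, hn, hae⟩ := hμ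
  have : ∀ i, Nonempty (RegularGraphOn d (n i)) := fun i => (hn i).2
  have : ∀ i, IsProbabilityMeasure (uniformRegularGraph d (n i)) := fun i =>
    ProbabilityTheory.instIsProbabilityMeasure_uniformOn_univ
  obtain ⟨G, hG⟩ := hae.exists
  exact ⟨n, fun i => (hn i).1, G, hG⟩

/-- Mixing `P` with weight exp(-δ) with the uniform distribution makes all weights positive, so that
information content is finite for every type, at the cost of at most δ in cross entropy. The affine
form in `P` preserves its symmetries. -/
theorem exists_smoothing {A : Type*} [Fintype A] (P : A → ℝ) (hP : ∀ a, 0 ≤ P a)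
    (hsum : ∑ a, P a = 1) (δ : ℝ) (hδ : 0 < δ) :
    ∃ ε η : ℝ, (∀ a, 0 < ε * P a + η) ∧ ∑ a, (ε * P a + η) = 1 ∧
      ∑ a, P a * -Real.log (ε * P a + η) ≤ ∑ a, Real.negMulLog (P a) + δ := by
  have hne : Nonempty A := by
    by_contra h
    rw [not_nonempty_iff] at h
    simp at hsum
  have hcard : (0 : ℝ) < Fintype.card A := by exact_mod_cast Fintype.card_pos
  have hexp : Real.exp (-δ) < 1 := Real.exp_lt_one_iff.2 (by linarith)
  have hη : 0 < (1 - Real.exp (-δ)) / Fintype.card A := div_pos (by linarith) hcard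
  refine ⟨Real.exp (-δ), (1 - Real.exp (-δ)) / Fintype.card A, fun a => ?_, ?_, ?_⟩
  · have := mul_nonneg (Real.exp_nonneg (-δ)) (hP a)
    linarith
  · rw [Finset.sum_add_distrib, ← Finset.mul_sum, hsum]
    simp only [Finset.sum_const, Finset.card_univ, nsmul_eq_mul]
    field_simp
    ring
  · have key : ∀ a, P a * -Real.log (Real.exp (-δ) * P a +
        (1 - Real.exp (-δ)) / Fintype.card A) ≤ Real.negMulLog (P a) + P a * δ := by
      intro a
      rcases (hP a).eq_or_lt with h | h
      · simp [← h]
      · have h1 : Real.log (Real.exp (-δ) * P a) ≤ Real.log (Real.exp (-δ) * P a +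
            (1 - Real.exp (-δ)) / Fintype.card A) :=
          Real.log_le_log (by positivity) (by linarith)
        rw [Real.log_mul (Real.exp_ne_zero _) h.ne', Real.log_exp] at h1
        rw [Real.negMulLog]
        nlinarith
    calc _ ≤ ∑ a, (Real.negMulLog (P a) + P a * δ) := Finset.sum_le_sum fun a _ => key a
      _ = _ := by rw [Finset.sum_add_distrib, ← Finset.sum_mul, hsum, one_mul]

/-- The star-edge entropy inequality for typical processes. -/
theorem IsTypical.star_edge_inequality (hd : 2 ≤ d) {μ : Measure (TreeVertex d → S)}
    (hμ : IsTypical d μ) (i₀ : Fin d) :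
    (d : ℝ) / 2 * ∑ q, Real.negMulLog (edgeLaw μ i₀ q) ≤ ∑ t, Real.negMulLog (starLaw μ t) := by
  classical
  by_contra! hlt
  obtain ⟨n, hn, hae⟩ := hμ
  have hne : ∀ i, Nonempty (RegularGraphOn d (n i)) := fun i => (hn i).2
  have hprob : ∀ i, IsProbabilityMeasure (uniformRegularGraph d (n i)) := fun i =>
    ProbabilityTheory.instIsProbabilityMeasure_uniformOn_univ
  obtain ⟨G₀, hgirth, hμprob, hinv, -⟩ := hae.exists
  have hninf := hgirth.tendsto_atTop hd (fun i => (hn i).1)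
  set hC := ∑ t, Real.negMulLog (starLaw μ t)
  set hE := ∑ q, Real.negMulLog (edgeLaw μ i₀ q)
  have hd0 : (0 : ℝ) < d := by positivity
  -- One δ is spent on smoothing, one on strictness for the star entropy and one on the edge
  -- entropy. With this denominator the remaining exponent is δ(d/2 + 2) > 0.
  set δ := (d / 2 * hE - hC) / (d + 4) with hδdef
  have hδ : 0 < δ := div_pos (by linarith) (by positivity)
  have hδ' : δ * (d + 4) = d / 2 * hE - hC := by
    rw [hδdef]
    field_simp
  obtain ⟨ε, η, hpos, hsum, hent⟩ := exists_smoothing (starLaw μ) (fun _ => measureReal_nonneg)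
    (sum_starLaw μ) δ hδ
  set p : S × (Fin d → S) → ℝ := fun t => ε * starLaw μ t + η with hp
  have hpsym : ∀ t t', StarEquiv t t' → p t = p t' := by
    rintro ⟨a, s⟩ ⟨a', s'⟩ ⟨h1, π, h2⟩
    simp only at h1 h2
    subst h1 h2
    simp only [hp]
    rw [← starLaw_perm hinv π (a, s')]
  let E : ∀ i, Set (RegularGraphOn d (n i)) := fun i =>
    goodGraphs (n i) p (hC + 2 * δ) (hE - δ)
  have hev : ∀ᵐ G ∂(Measure.infinitePi fun i => uniformRegularGraph d (n i)),
      ∃ N, ∀ i, N ≤ i → G i ∈ E i := by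
    filter_upwards [hae] with G hG
    obtain ⟨-, -, -, f, hf⟩ := hG
    exact eventually_atTop.1 (eventually_mem_goodGraphs (fun i => (hn i).1) G hinv hf i₀ p hpsym
      _ _ (by linarith) (by linarith))
  have hhalf : ∀ᶠ i in atTop, uniformRegularGraph d (n i) (E i) ≤ 1 / 2 := by
    have hκ : 0 < (d : ℝ) / 2 * (hE - δ) - (hC + 2 * δ) := by nlinarith
    have hsmall := ((tendsto_polynomial_mul_exp_neg d (8 * d ^ 2) (Fintype.card (S × S)) _
      hκ).comp hninf).eventually_lt_const (show (0 : ℝ) < 1 / 2 by norm_num)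
    filter_upwards [hsmall, hninf.eventually_gt_atTop (16 * d)] with i hi1 hi2
    refine uniformRegularGraph_le_half _ ?_ (hne i)
    refine (ncard_goodGraphs_le (by omega) hi2 p hpos hsum.le _ _ (hne i)).trans ?_
    exact mul_le_mul_of_nonneg_left hi1.le (Nat.cast_nonneg _)
  -- These events increase to one of full measure, yet `A N` lies in the event that the N-th graph
  -- is good, of probability at most 1/2 for large `N`.
  let A : ℕ → Set (∀ i, RegularGraphOn d (n i)) := fun N => {G | ∀ i, N ≤ i → G i ∈ E i}
  have hA : Monotone A := fun N N' hNN' G hG i hi => hG i (hNN'.trans hi)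
  have hlim := tendsto_measure_iUnion_atTop
    (μ := Measure.infinitePi fun i => uniformRegularGraph d (n i)) hA
  have hfull : (Measure.infinitePi fun i => uniformRegularGraph d (n i)) (⋃ N, A N) = 1 := by
    refine (measure_congr (eventuallyEq_univ.2 ?_)).trans measure_univ
    filter_upwards [hev] with G hG
    exact Set.mem_iUnion.2 hG
  rw [hfull] at hlim
  have hle : (1 : ENNReal) ≤ 1 / 2 := by
    refine le_of_tendsto hlim ?_
    filter_upwards [hhalf] with N hN
    refine le_trans (measure_mono fun G hG => ?_) ((le_of_eq
      ((measurePreserving_eval_infinitePi (fun i => uniformRegularGraph d (n i)) N).measure_preimage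
        (s := E N) (MeasurableSet.nullMeasurableSet trivial))).trans hN)
    exact hG N le_rfl
  norm_num at hle

end starEdge

/-! ### Entropies of stars -/

section final

variable {S : Type*} [Fintype S] [MeasurableSpace S] [MeasurableSingletonClass S]

/-- Allows a set of vertices to be encoded by any convenient tuple of colors, as needed for
submodularity and for comparison with `starLaw`. -/
theorem configEntropy_eq_varEntropy {V B : Type*} [DecidableEq V] [Fintype B]
    (μ : Measure (V → S)) (F : Finset V) (Y : (V → S) → B)
    (hY : ∀ x x', (∀ v ∈ F, x v = x' v) ↔ Y x = Y x') :
    configEntropy μ F = varEntropy μ Y := by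
  rw [← varEntropy_congr μ (F.restrict : (V → S) → F → S) Y, configEntropy, shannonEntropy,
    varEntropy]
  · refine Finset.sum_congr rfl fun a _ => ?_
    rw [marginal, map_measureReal_apply (Finset.measurable_restrict F) (measurableSet_singleton a)]
  · intro x x'
    rw [← hY, funext_iff]
    exact Subtype.forall

theorem totalCorrelation_eq {V : Type*} [DecidableEq V] (μ : Measure (V → S))
    [IsProbabilityMeasure μ] (F : Finset V) :
    totalCorrelation μ F =
      ∑ v ∈ F, varEntropy μ (fun x : V → S => x v) - configEntropy μ F := by
  have : IsProbabilityMeasure (marginal μ F) :=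
    Measure.isProbabilityMeasure_map (Finset.measurable_restrict F).aemeasurable
  have : ∀ v : F, IsProbabilityMeasure ((marginal μ F).map fun x => x v) := fun v =>
    Measure.isProbabilityMeasure_map (measurable_pi_apply v).aemeasurable
  rw [totalCorrelation, productMarginal, shannonEntropy_pi,
    ← Finset.sum_coe_sort F fun v => varEntropy μ (fun x : V → S => x v)]
  congr 1
  refine Finset.sum_congr rfl fun v _ => Finset.sum_congr rfl fun s _ => ?_
  have hmap : (marginal μ F).map (fun x => x v) = μ.map (fun x => x v) := by
    rw [marginal]
    exact Measure.map_map (measurable_pi_apply v) (Finset.measurable_restrict F)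
  rw [hmap, map_measureReal_apply (measurable_pi_apply _) (measurableSet_singleton s)]

/-- Pinsker's inequality for the total correlation. -/
theorem tvDist_le_sqrt_totalCorrelation {V : Type*} [DecidableEq V] (μ : Measure (V → S))
    [IsProbabilityMeasure μ] (F : Finset V) :
    tvDist (marginal μ F) (productMarginal μ F) ≤ √(totalCorrelation μ F / 2) := by
  have : IsProbabilityMeasure (marginal μ F) :=
    Measure.isProbabilityMeasure_map (Finset.measurable_restrict F).aemeasurable
  have : ∀ v : F, IsProbabilityMeasure ((marginal μ F).map fun x => x v) := fun v =>
    Measure.isProbabilityMeasure_map (measurable_pi_apply v).aemeasurable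
  have : IsProbabilityMeasure (productMarginal μ F) := by
    unfold productMarginal
    infer_instance
  obtain ⟨hac, hlog⟩ := sum_real_mul_log_pi (fun v : F => (marginal μ F).map fun x => x v)
    (marginal μ F) fun _ => rfl
  -- The relative entropy with respect to the product of the marginals is exactly the total
  -- correlation.
  have hkl : ∑ a, (marginal μ F).real {a} * (Real.log ((marginal μ F).real {a}) -
      Real.log ((productMarginal μ F).real {a})) = totalCorrelation μ F := by
    rw [totalCorrelation, configEntropy, productMarginal, shannonEntropy_pi]
    simp only [mul_sub, Finset.sum_sub_distrib]
    rw [hlog, shannonEntropy]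
    simp only [Real.negMulLog, neg_mul, Finset.sum_neg_distrib]
    ring
  have : Nonempty {B : Set (F → S) // MeasurableSet B} := ⟨⟨∅, MeasurableSet.empty⟩⟩
  refine ciSup_le fun B => Real.abs_le_sqrt ?_
  have := pinsker_finite (marginal μ F) (productMarginal μ F) hac B.1
  rw [hkl] at this
  linarith

variable {d : ℕ} {μ : Measure (TreeVertex d → S)}

theorem varEntropy_vertex (hμ : IsInvariantProcess d μ) (o : TreeVertex d) :
    varEntropy μ (fun x => x o) = varEntropy μ (fun x => x (treeRoot d)) :=
  Finset.sum_congr rfl fun s _ => by rw [real_single_preimage hμ]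

theorem varEntropy_edge (hμ : IsInvariantProcess d μ) (i : Fin d) {o w : TreeVertex d}
    (how : (regularTree d).Adj o w) :
    varEntropy μ (fun x => (x o, x w)) = ∑ q, Real.negMulLog (edgeLaw μ i q) := by
  obtain ⟨j, rfl⟩ := (treeAdj_iff o w).1 how
  exact Finset.sum_congr rfl fun q _ => by rw [real_pair_preimage hμ i j]

theorem configEntropy_treeStar (hμ : IsInvariantProcess d μ) (o : TreeVertex d) :
    configEntropy μ (treeStar d o) = ∑ t, Real.negMulLog (starLaw μ t) := by
  rw [configEntropy_eq_varEntropy μ _ (starColors o)]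
  · exact Finset.sum_congr rfl fun t _ => by
      rw [← real_starColors_preimage hμ 1 o t]
      rfl
  · intro x x'
    simp only [starColors, treeStar, Finset.mem_insert, SimpleGraph.mem_neighborFinset,
      treeAdj_iff, forall_eq_or_imp, forall_exists_index, forall_apply_eq_imp_iff, Prod.mk.injEq,
      funext_iff]

/-- By submodularity, a star with few leaves has entropy at most that of a star with conditionally
independent leaves. -/
theorem configEntropy_insert_le [IsProbabilityMeasure μ] (hμ : IsInvariantProcess d μ)
    (i : Fin d) (o : TreeVertex d) (F : Finset (TreeVertex d))
    (hF : ∀ w ∈ F, (regularTree d).Adj o w) :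
    configEntropy μ (insert o F) ≤ varEntropy μ (fun x => x (treeRoot d)) +
      F.card * (∑ q, Real.negMulLog (edgeLaw μ i q) - varEntropy μ (fun x => x (treeRoot d))) := by
  induction F using Finset.induction_on with
  | empty =>
    rw [configEntropy_eq_varEntropy μ _ (fun x => x o) (by simp), varEntropy_vertex hμ]
    simp
  | insert w F hw ih =>
    have ih := ih fun v hv => hF v (Finset.mem_insert_of_mem hv)
    have how := hF w (Finset.mem_insert_self w F)
    -- Conditioning on the center: the new leaf adds at most its conditional entropy given the
    -- center alone, h(e) - h(v).
    have hsub := varEntropy_submodular μ (fun x : TreeVertex d → S => x w)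
      (F.restrict : (TreeVertex d → S) → F → S) (fun x => x o)
      (fun s => measurable_pi_apply w (measurableSet_singleton s))
      (fun a => Finset.measurable_restrict F (measurableSet_singleton a))
    rw [← configEntropy_eq_varEntropy μ (insert o (insert w F)), varEntropy_vertex hμ,
      ← configEntropy_eq_varEntropy μ (insert o F) (fun x => (F.restrict x, x o)),
      varEntropy_congr μ (fun x => (x w, x o)) (fun x => (x o, x w)),
      varEntropy_edge hμ i how] at hsub
    · rw [Finset.card_insert_of_notMem hw]
      push_cast
      linarith
    · intro x x'
      simp only [Prod.mk.injEq]
      exact and_comm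
    · intro x x'
      simp only [Finset.mem_insert, forall_eq_or_imp, Prod.mk.injEq, funext_iff, Subtype.forall,
        Finset.restrict]
      exact and_comm
    · intro x x'
      simp only [Finset.mem_insert, forall_eq_or_imp, Prod.mk.injEq, funext_iff, Subtype.forall,
        Finset.restrict]
      tauto

end final

end

/-! ### Combining the inequalities for the star without a leaf -/

theorem proposition4p5 {S : Type*} [Fintype S] [MeasurableSpace S] [MeasurableSingletonClass S]
    (d : ℕ) (hd : 3 ≤ d) (μ : Measure (TreeVertex d → S)) (hμ : IsTypical d μ)
    (o w₁ : TreeVertex d) (hw₁ : (regularTree d).Adj o w₁) (b : ℝ) (hb : 0 ≤ b)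
    (h : configEntropy μ (treeStar d o) - configEntropy μ ((treeStar d o).erase w₁) ≤ b) :
    totalCorrelation μ ((treeStar d o).erase w₁) ≤ b * ((2 * d - 2) / (d - 2)) ∧
      tvDist (marginal μ ((treeStar d o).erase w₁)) (productMarginal μ ((treeStar d o).erase w₁)) ≤
        √(b * (d - 1) / (d - 2)) := by
  obtain ⟨n, hn, G, -, hprob, hinv, -⟩ := hμ.exists_memProfile
  have i₀ : Fin d := ⟨0, by omega⟩
  have hstar := hμ.star_edge_inequality (by omega) i₀
  have hd' : (3 : ℝ) ≤ d := by exact_mod_cast hd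
  have hmem : w₁ ∈ (regularTree d).neighborFinset o :=
    (SimpleGraph.mem_neighborFinset _ _ _).2 hw₁
  have herase : (treeStar d o).erase w₁ =
      insert o (((regularTree d).neighborFinset o).erase w₁) :=
    Finset.erase_insert_of_ne hw₁.ne
  have hcard : (((regularTree d).neighborFinset o).erase w₁).card = d - 1 := by
    rw [Finset.card_erase_of_mem hmem, SimpleGraph.card_neighborFinset_eq_degree,
      regularTree_degree d o]
  have hcard' : (((regularTree d).neighborFinset o).erase w₁).card + 1 = (d : ℝ) := by
    rw [hcard]
    exact_mod_cast Nat.sub_add_cancel (by omega)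
  have hle := configEntropy_insert_le hinv i₀ o (((regularTree d).neighborFinset o).erase w₁)
    fun w hw => (SimpleGraph.mem_neighborFinset _ _ _).1 (Finset.mem_of_mem_erase hw)
  rw [← configEntropy_treeStar hinv o] at hstar
  have htc := totalCorrelation_eq μ ((treeStar d o).erase w₁)
  simp only [varEntropy_vertex hinv, Finset.sum_const, nsmul_eq_mul] at htc
  have hcard'' : ((((treeStar d o).erase w₁).card : ℕ) : ℝ) = d := by
    rw [herase, Finset.card_insert_of_notMem (by simp), ← hcard']
    push_cast
    rfl
  rw [hcard''] at htc
  rw [← herase, eq_sub_of_add_eq hcard'] at hle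
  set hv := varEntropy μ fun x : TreeVertex d → S => x (treeRoot d)
  set he := ∑ q, Real.negMulLog (edgeLaw μ i₀ q)
  set hC := configEntropy μ (treeStar d o)
  set hC' := configEntropy μ ((treeStar d o).erase w₁)
  have key : totalCorrelation μ ((treeStar d o).erase w₁) ≤ b * ((2 * d - 2) / (d - 2)) := by
    rw [htc, mul_div_assoc', le_div_iff₀ (by linarith)]
    -- The assumption and the star-edge inequality enter with weight 2(d - 1), the submodular bound
    -- with weight d; `hC` and `he` then cancel.
    nlinarith
  refine ⟨key, (tvDist_le_sqrt_totalCorrelation μ _).trans (Real.sqrt_le_sqrt ?_)⟩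
  calc _ ≤ b * ((2 * d - 2) / (d - 2)) / 2 := by linarith
    _ = _ := by ring
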